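/- Let $K\ge 2$, $g_1,\dots,g_K>0$, $\sigma>0$ and $0<\alpha\le 1$. A base station with two transmit antennas serves $K$ single-antenna users. The channel vectors $\mathbf h_1,\dots,\mathbf h_K\in\mathbb C^2$ have $2K$ independent $\mathcal{CN}(0,1)$ entries. The set $\mathcal U$ of served users has one or two elements, the total transmit power is $2$, and with $\rho=2/|\mathcal U|$ the SINR of $i\in\mathcal U$ is $$\mathrm{SINR}_i^l=\frac{g_i|\mathbf h_i^{\mathrm H}\mathbf w_i|^2}{\sigma^2/\rho+g_i\sum_{j\in\mathcal U,\,j\ne i}|\mathbf h_i^{\mathrm H}\mathbf w_j|^2},$$ where for $l=\mathrm{MRT}$ the beam is $\mathbf w_i=\mathbf h_i/\|\mathbf h_i\|$, and for $l=\mathrm{ZF}$ it is the normalized orthogonal projection of $\mathbf h_i$ onto the orthogonal complement of $\{\mathbf h_j: j\in\mathcal U,\ j\ne i\}$. In the Max-Gain (MUS) scheme the first selected user is $\pi(1)=\arg\max_{k} g_k\|\mathbf h_k\|^2$. The second is $\pi(2)=\arg\max_{j\in\mathcal X} g_j\|\mathbf h_j\|^2$, where $\mathcal X$ is the set of users $j\ne\pi(1)$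 with $|\mathbf h_{\pi(1)}^{\mathrm H}\mathbf h_j|^2\le\alpha^2\|\mathbf h_{\pi(1)}\|^2\|\mathbf h_j\|^2$. MU-Mode is the event $\mathcal X\neq\emptyset$; in it, $\mathcal U=\{\pi(1),\pi(2)\}$. Let $\lambda=(1-\alpha^2)^{K-1}$, and let $\mathcal R^l_{M2}(\alpha)=\mathbb E[\log(1+\mathrm{SINR}^l_{\pi(2)})\mid\text{MU-Mode}]$ be the ergodic rate of $\pi(2)$ under MU-Mode. For $1\le k\le K$ and $2\le i\le K$ let $\mathbf C^k_{(i)}$ be the $\binom{K-1}{K-i}\times(K-i)$ matrix whose rows are the combinations of $K-i$ indices from $\{1,\dots,K\}\setminus\{k\}$, and let $\overline{\mathbf C}^k_{(i)}$ be the $\binom{K-1}{K-i}\times(i-1)$ matrix whose $m$-th row lists the elements of $\{1,\dots,K\}\setminus\{k\}$ that are not in the $m$-th row of $\mathbf C^k_{(i)}$. Let $\gamma(2,x)=\int_0^x te^{-t}\,dt$ and $\Gamma(2,x)=\int_x^\infty te^{-t}\,dt$, and $$\Upsilon^{\mathrm{MRT}}(x)=\log\frac{1+x+\alpha^2x}{1+x}+\frac1x\log\frac{1+(x^{-1}+\alpha^2)^{-1}}{1+x}+\alpha^2\log\bigl(1+(x^{-1}+\alpha^2)^{-1}\bigr),$$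 $$\Upsilon^{\mathrm{ZF}}(x)=\frac1x\Bigl\{(1+x)\log(1+x)-[1+(1-\alpha^2)x]\log[1+(1-\alpha^2)x]\Bigr\}-\alpha^2 .$$ Then MU-Mode has probability $1-\lambda$, and for $l\in\{\mathrm{MRT},\mathrm{ZF}\}$ the expectation defining $\mathcal R^l_{M2}(\alpha)$ is finite, the integrals below converge absolutely, and $$\mathcal R^l_{M2}(\alpha)=\sum_{i=2}^K\frac{(1-\alpha^2)^{i-2}}{1-\lambda}\sum_{k=1}^K\frac{\sigma^4}{g_k^2}\int_0^\infty\Upsilon^l(x)\,x\,e^{-\sigma^2x/g_k}\sum_{m=1}^{\binom{K-1}{K-i}}\prod_{j=1}^{K-i}\gamma\Bigl(2,\tfrac{\sigma^2}{g_{\mathbf C^k_{(i)}(m,j)}}x\Bigr)\prod_{j=1}^{i-1}\Gamma\Bigl(2,\tfrac{\sigma^2}{g_{\overline{\mathbf C}^k_{(i)}(m,j)}}x\Bigr)dx .$$ -/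

import Mathlib

open MeasureTheory ProbabilityTheory
open scoped InnerProductSpace

namespace MaxGain

noncomputable section

/-! ### Channels and beamforming -/

/-- The circularly symmetric complex Gaussian law `CN(0,1)`: the real and the imaginary part are
independent real Gaussians with mean `0` and variance `1/2`. -/
def stdComplexGaussian : Measure ℂ :=
  ((gaussianReal 0 (1 / 2)).prod (gaussianReal 0 (1 / 2))).map
    (fun p : ℝ × ℝ => (⟨p.1, p.2⟩ : ℂ))

/-- The two beamforming methods: maximum ratio transmission and zero forcing. -/
inductive Beamforming
  | MRT
  | ZF

variable {K : ℕ}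

/-- The (unnormalised) direction in which the beam of user `i` points when the users in `U` are
served: the channel of `i` for MRT, and for ZF the orthogonal projection of the channel of `i` onto
the orthogonal complement of the channels of the other served users. -/
def beamDirection (l : Beamforming) (h : Fin K → EuclideanSpace ℂ (Fin 2)) (U : Finset (Fin K))
    (i : Fin K) : EuclideanSpace ℂ (Fin 2) :=
  match l with
  | Beamforming.MRT => h i
  | Beamforming.ZF => (Submodule.span ℂ (h '' {j | j ∈ U ∧ j ≠ i}))ᗮ.starProjection (h i)

/-- The unit-norm beamforming vector of user `i`. -/
def beam (l : Beamforming) (h : Fin K → EuclideanSpace ℂ (Fin 2)) (U : Finset (Fin K))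
    (i : Fin K) : EuclideanSpace ℂ (Fin 2) :=
  (‖beamDirection l h U i‖)⁻¹ • beamDirection l h U i

/-- The effective noise power `σ² / ρ`, where the total transmit power `2` is shared equally by the
served users, `ρ = 2 / |U|`. -/
def effNoise (σ : ℝ) (U : Finset (Fin K)) : ℝ := σ ^ 2 / (2 / (U.card : ℝ))

/-- The SINR of user `i` when the users in `U` are served. -/
def sinr (l : Beamforming) (σ : ℝ) (g : Fin K → ℝ) (h : Fin K → EuclideanSpace ℂ (Fin 2))
    (U : Finset (Fin K)) (i : Fin K) : ℝ :=
  g i * ‖⟪h i, beam l h U i⟫_ℂ‖ ^ 2 /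
    (effNoise σ U + g i * ∑ j ∈ U.erase i, ‖⟪h i, beam l h U j⟫_ℂ‖ ^ 2)

/-! ### Max-gain user selection -/

/-- The semi-orthogonality constraint. -/
def SemiOrthogonal (α : ℝ) (u v : EuclideanSpace ℂ (Fin 2)) : Prop :=
  ‖⟪u, v⟫_ℂ‖ ^ 2 / (‖u‖ ^ 2 * ‖v‖ ^ 2) ≤ α ^ 2

/-- The received power gain of user `k`. -/
def gain (g : Fin K → ℝ) (h : Fin K → EuclideanSpace ℂ (Fin 2)) (k : Fin K) : ℝ :=
  g k * ‖h k‖ ^ 2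

/-- The first selected user: a user of maximal gain (the first one in case of a tie;
`none` only if there are no users at all). -/
def firstUser (g : Fin K → ℝ) (h : Fin K → EuclideanSpace ℂ (Fin 2)) : Option (Fin K) :=
  (List.finRange K).argmax (gain g h)

open Classical in
/-- The list of the users other than `i` that are semi-orthogonal to user `i`. -/
def candidates (α : ℝ) (h : Fin K → EuclideanSpace ℂ (Fin 2)) (i : Fin K) : List (Fin K) :=
  (List.finRange K).filter (fun j => decide (j ≠ i ∧ SemiOrthogonal α (h i) (h j)))

/-- The second selected user: a user of maximal gain among those semi-orthogonal to the first
selected user; `none` if there is no such user. -/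
def secondUser (α : ℝ) (g : Fin K → ℝ) (h : Fin K → EuclideanSpace ℂ (Fin 2)) :
    Option (Fin K) :=
  (firstUser g h).bind (fun i => (candidates α h i).argmax (gain g h))

/-- The instantaneous rate of the second selected user when both selected users are served
(and `0` when there is no second selected user). -/
def secondUserRate (l : Beamforming) (σ α : ℝ) (g : Fin K → ℝ)
    (h : Fin K → EuclideanSpace ℂ (Fin 2)) : ℝ :=
  match firstUser g h, secondUser α g h with
  | some i, some j => Real.log (1 + sinr l σ g h {i, j} j)
  | _, _ => 0

/-- The event that the base station operates in MU-Mode, that is, that there is a second selected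
user. -/
def muMode {Ω : Type*} (α : ℝ) (g : Fin K → ℝ) (h : Fin K → Ω → EuclideanSpace ℂ (Fin 2)) :
    Set Ω :=
  {ω | (secondUser α g (fun k => h k ω)).isSome = true}

/-- The ergodic rate of the second selected user under MU-Mode: the conditional expectation of its
instantaneous rate given the event that the base station operates in MU-Mode. -/
def ergodicRateSecond {Ω : Type*} [MeasurableSpace Ω] (μ : Measure Ω) (l : Beamforming)
    (σ α : ℝ) (g : Fin K → ℝ) (h : Fin K → Ω → EuclideanSpace ℂ (Fin 2)) : ℝ :=
  ∫ ω, secondUserRate l σ α g (fun k => h k ω) ∂(ProbabilityTheory.cond μ (muMode α g h))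

/-! ### The closed form -/

/-- The lower incomplete Gamma function `γ(s, x)`. -/
def lowerGamma (s x : ℝ) : ℝ := ∫ t in (0 : ℝ)..x, t ^ (s - 1) * Real.exp (-t)

/-- The upper incomplete Gamma function `Γ(s, x)`. -/
def upperGamma (s x : ℝ) : ℝ := ∫ t in Set.Ioi x, t ^ (s - 1) * Real.exp (-t)

/-- The function `Υ` for the two beamforming methods. -/
def Upsilon (l : Beamforming) (α x : ℝ) : ℝ :=
  match l with
  | Beamforming.MRT =>
      Real.log ((1 + x + α ^ 2 * x) / (1 + x))
        + 1 / x * Real.log ((1 + (x⁻¹ + α ^ 2)⁻¹) / (1 + x))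
        + α ^ 2 * Real.log (1 + (x⁻¹ + α ^ 2)⁻¹)
  | Beamforming.ZF =>
      1 / x * ((1 + x) * Real.log (1 + x)
        - (1 + (1 - α ^ 2) * x) * Real.log (1 + (1 - α ^ 2) * x)) - α ^ 2

/-- The combinations of `r` indices out of all indices except `k`, each in increasing order, listed
lexicographically. -/
def combinations (k : Fin K) (r : ℕ) : List (List (Fin K)) :=
  (List.sublistsLen r ((List.finRange K).erase k)).reverse

theorem length_combinations (k : Fin K) (r : ℕ) :
    (combinations k r).length = (K - 1).choose r := by
  simp [combinations, List.length_sublistsLen, List.length_erase_of_mem]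

theorem length_of_mem_combinations {k : Fin K} {r : ℕ} {s : List (Fin K)}
    (hs : s ∈ combinations k r) : s.length = r := by
  rw [combinations, List.mem_reverse, List.mem_sublistsLen] at hs
  exact hs.2

/-- The `m`-th combination of `K - i` indices out of all indices except `k`. -/
def combRow (k : Fin K) (i : ℕ) (m : Fin ((K - 1).choose (K - i))) : List (Fin K) :=
  (combinations k (K - i))[(m : ℕ)]'(by rw [length_combinations]; exact m.2)

theorem length_combRow (k : Fin K) (i : ℕ) (m : Fin ((K - 1).choose (K - i))) :
    (combRow k i m).length = K - i :=
  length_of_mem_combinations (List.getElem_mem _)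

/-- The matrix whose rows are the combinations of `K - i` indices out of all indices except
`k`. -/
def combMatrix (k : Fin K) (i : ℕ) :
    Matrix (Fin ((K - 1).choose (K - i))) (Fin (K - i)) (Fin K) :=
  Matrix.of fun m j => (combRow k i m)[(j : ℕ)]'(by rw [length_combRow]; exact j.2)

/-- The indices other than `k` that are missing in the `m`-th row of `combMatrix k i`, in increasing
order. -/
def compRow (k : Fin K) (i : ℕ) (m : Fin ((K - 1).choose (K - i))) : List (Fin K) :=
  ((List.finRange K).erase k).filter (fun a => decide (a ∉ combRow k i m))

theorem length_compRow (k : Fin K) (i : ℕ) (h1 : 1 ≤ i) (hi : i ≤ K)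
    (m : Fin ((K - 1).choose (K - i))) : (compRow k i m).length = i - 1 := by
  have hL : ((List.finRange K).erase k).Nodup := (List.nodup_finRange K).erase k
  have hmem : combRow k i m ∈ combinations k (K - i) := List.getElem_mem _
  rw [combinations, List.mem_reverse, List.mem_sublistsLen] at hmem
  have hrow : (combRow k i m).Nodup := hmem.1.nodup hL
  have hsub : (combRow k i m).toFinset ⊆ ((List.finRange K).erase k).toFinset := by
    intro a ha
    rw [List.mem_toFinset] at ha ⊢
    exact hmem.1.subset ha
  have hset : (compRow k i m).toFinset
      = ((List.finRange K).erase k).toFinset \ (combRow k i m).toFinset := by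
    ext a
    simp [compRow]
  have hcomp : (compRow k i m).Nodup := hL.filter _
  rw [← List.toFinset_card_of_nodup hcomp, hset, Finset.card_sdiff_of_subset hsub,
    List.toFinset_card_of_nodup hL, List.toFinset_card_of_nodup hrow, hmem.2,
    List.length_erase_of_mem (List.mem_finRange k), List.length_finRange]
  omega

/-- The matrix whose `m`-th row consists of the indices other than `k` that are missing in the
`m`-th row of `combMatrix k i`. For `1 ≤ i ≤ K` these are exactly `i - 1` indices, by
`length_compRow`, so that the default value `k` is never used. -/
def compMatrix (k : Fin K) (i : ℕ) :
    Matrix (Fin ((K - 1).choose (K - i))) (Fin (i - 1)) (Fin K) :=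
  Matrix.of fun m j => (compRow k i m).getD (j : ℕ) k

/-- The integrand of the closed form for the rank `i` and the user `k`. -/
def rateIntegrand (l : Beamforming) (σ α : ℝ) (g : Fin K → ℝ) (i : ℕ) (k : Fin K) (x : ℝ) : ℝ :=
  Upsilon l α x * x * Real.exp (-(σ ^ 2 / g k * x)) *
    ∑ m : Fin ((K - 1).choose (K - i)),
      (∏ j : Fin (K - i), lowerGamma 2 (σ ^ 2 / g (combMatrix k i m j) * x)) *
        ∏ j : Fin (i - 1), upperGamma 2 (σ ^ 2 / g (compMatrix k i m j) * x)

/-- The number `λ`, the probability of SU-Mode. -/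
def suProb (K : ℕ) (α : ℝ) : ℝ := (1 - α ^ 2) ^ (K - 1)

end

end MaxGain

open MaxGain

namespace MaxGain

open scoped ENNReal

/-! ### The complex Gaussian law -/

/-! A channel vector is a rotation-invariant Gaussian on `ℂ²`. Its squared norm therefore has
density `t e^{-t}`, and its squared correlation with any fixed nonzero vector is uniform on `(0,1]`
and independent of the norm (`channelLaw_map_norm_corr`). Conditioning on the channel of a user `p`,
the correlations of the other users with `p` are i.i.d. uniform and independent of all norms. This
is `lintegral_norm_corr`: functions of norms and correlations may be integrated as if these were
independent.

The gains depend on the norms alone, and almost surely there are no ties. Let `p` have the largest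
gain. A user `k` of rank `i` in the gain order is selected second exactly when `k` passes the
correlation test and the `i - 2` users ranked strictly between `p` and `k` fail it. Each failure has
probability `1 - α²`. The SINR of `k` depends only on its normalised gain `x` and its correlation
`v` with `p` (`sinr_pair`), so integrating over the `v` that pass gives `∫₀^{α²} log(1 + SINR(x,v))
dv`, which is `Υ(x)` (`integral_log_one_add_pairSinr`). The sum over `p` thus becomes a sum over
ranks (`lintegral_selWeight`, `sum_isMax_eq_sum_rank`).

It remains to integrate over the norms with `k` of rank `i`. Given the normalised gain `x` of `k`,
another user `j` is weaker with probability `γ(2, σ²x/g_j)` and stronger with probability `Γ(2,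
σ²x/g_j)`. Summing over the possible sets of `K - i` weaker users gives the sum over matrix rows,
and rescaling the density of the norm gives the factor `σ⁴/g_k²` (`lintegral_rank`).

SU-Mode means that all `K - 1` other users fail the test, whence its probability `λ`. The rate
vanishes there, so the conditional mean is the full mean divided by `1 - λ`. Averages are computed
with nonnegative integrals, where Fubini needs only measurability; finiteness comes afterwards from
`Υ(x) ≤ x`. -/

lemma measurable_complex_mk : Measurable (fun p : ℝ × ℝ => (⟨p.1, p.2⟩ : ℂ)) :=
  Complex.measurableEquivRealProd.symm.measurable

instance : IsProbabilityMeasure stdComplexGaussian :=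
  Measure.isProbabilityMeasure_map measurable_complex_mk.aemeasurable

lemma charFun_stdComplexGaussian (t : ℂ) :
    charFun stdComplexGaussian t = Complex.exp (-(‖t‖ : ℂ) ^ 2 / 4) := by
  rw [charFun_apply, stdComplexGaussian, integral_map measurable_complex_mk.aemeasurable
    (by fun_prop)]
  have h1 : ∀ p : ℝ × ℝ, Complex.exp (((⟪(⟨p.1, p.2⟩ : ℂ), t⟫_ℝ : ℝ) : ℂ) * Complex.I)
      = Complex.exp (t.re * p.1 * Complex.I) * Complex.exp (t.im * p.2 * Complex.I) := by
    intro p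
    rw [← Complex.exp_add, Complex.inner]
    congr 1
    simp
    ring
  simp_rw [h1]
  rw [integral_prod_mul (fun x : ℝ => Complex.exp (t.re * x * Complex.I))
    (fun y : ℝ => Complex.exp (t.im * y * Complex.I)), ← charFun_apply_real, ← charFun_apply_real,
    charFun_gaussianReal, charFun_gaussianReal, ← Complex.exp_add]
  congr 1
  have h2 : (‖t‖ : ℂ) ^ 2 = (t.re : ℂ) ^ 2 + (t.im : ℂ) ^ 2 := by
    exact_mod_cast (by rw [Complex.sq_norm, Complex.normSq_apply]; ring :
      ‖t‖ ^ 2 = t.re ^ 2 + t.im ^ 2)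
  rw [h2]
  push_cast
  ring

/-- The squared modulus of a complex Gaussian is exponentially distributed. -/
lemma lintegral_normSq_stdComplexGaussian {f : ℝ → ℝ≥0∞} (hf : Measurable f) :
    ∫⁻ z, f (‖z‖ ^ 2) ∂stdComplexGaussian
      = ∫⁻ s in Set.Ioi (0 : ℝ), ENNReal.ofReal (Real.exp (-s)) * f s := by
  have hpi : (0 : ℝ) < Real.pi := Real.pi_pos
  have hf' : Measurable fun a : ℝ × ℝ => f (‖(⟨a.1, a.2⟩ : ℂ)‖ ^ 2) :=
    hf.comp ((by fun_prop : Measurable fun z : ℂ => ‖z‖ ^ 2).comp measurable_complex_mk)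
  rw [stdComplexGaussian, lintegral_map (by fun_prop) measurable_complex_mk]
  have hv : (1 / 2 : NNReal) ≠ 0 := by norm_num
  rw [gaussianReal_of_var_ne_zero _ hv,
    prod_withDensity (measurable_gaussianPDF _ _) (measurable_gaussianPDF _ _),
    lintegral_withDensity_eq_lintegral_mul _ (by fun_prop) hf',
    ← Measure.volume_eq_prod, ← lintegral_comp_polarCoord_symm, polarCoord_target]
  have h1 : ∀ p : ℝ × ℝ, ENNReal.ofReal p.1 • (((fun z : ℝ × ℝ => gaussianPDF 0 (1 / 2) z.1 *
      gaussianPDF 0 (1 / 2) z.2) * fun a : ℝ × ℝ => f (‖(⟨a.1, a.2⟩ : ℂ)‖ ^ 2))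
        (polarCoord.symm p)) = ENNReal.ofReal p.1 *
          (ENNReal.ofReal (Real.pi⁻¹ * Real.exp (-p.1 ^ 2)) * f (p.1 ^ 2)) := by
    rintro ⟨r, θ⟩
    have e1 : ‖(⟨r * Real.cos θ, r * Real.sin θ⟩ : ℂ)‖ ^ 2 = r ^ 2 := by
      rw [Complex.sq_norm, Complex.normSq_mk]
      linear_combination r ^ 2 * Real.sin_sq_add_cos_sq θ
    have e2 : gaussianPDF 0 (1 / 2) (r * Real.cos θ) * gaussianPDF 0 (1 / 2) (r * Real.sin θ)
        = ENNReal.ofReal (Real.pi⁻¹ * Real.exp (-r ^ 2)) := by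
      rw [gaussianPDF, gaussianPDF, ← ENNReal.ofReal_mul (gaussianPDFReal_nonneg _ _ _)]
      congr 1
      simp only [gaussianPDFReal]
      rw [mul_mul_mul_comm, ← Real.exp_add, ← mul_inv, Real.mul_self_sqrt (by positivity)]
      push_cast
      congr 2
      · ring
      · linear_combination -r ^ 2 * Real.sin_sq_add_cos_sq θ
    simp only [polarCoord_symm_apply, Pi.mul_apply, smul_eq_mul]
    rw [e1, e2]
  simp_rw [h1]
  rw [Measure.volume_eq_prod, ← Measure.prod_restrict, lintegral_prod _ (by fun_prop)]
  simp only [lintegral_const, Measure.restrict_apply_univ, Real.volume_Ioo]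
  -- Substitution `s = r²`: the angular length `2π` against the density constant `π⁻¹` leaves `2r`,
  -- exactly the Jacobian.
  have himg : (fun r : ℝ => r ^ 2) '' Set.Ioi 0 = Set.Ioi 0 := by
    ext s
    constructor
    · rintro ⟨r, hr, rfl⟩
      exact pow_pos (Set.mem_Ioi.1 hr) 2
    · intro hs
      exact ⟨Real.sqrt s, Real.sqrt_pos.2 hs, Real.sq_sqrt (le_of_lt hs)⟩
  have hmono : MonotoneOn (fun r : ℝ => r ^ 2) (Set.Ioi 0) := fun a ha b _ hab =>
    pow_le_pow_left₀ (le_of_lt ha) hab 2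
  have hder : ∀ x ∈ Set.Ioi (0 : ℝ), HasDerivWithinAt (fun r : ℝ => r ^ 2) (2 * x) (Set.Ioi 0) x :=
    fun x _ => by simpa using (hasDerivAt_pow 2 x).hasDerivWithinAt
  have hsub := lintegral_image_eq_lintegral_deriv_mul_of_monotoneOn measurableSet_Ioi hder hmono
    (fun s => ENNReal.ofReal (Real.exp (-s)) * f s)
  rw [himg] at hsub
  rw [hsub]
  refine setLIntegral_congr_fun measurableSet_Ioi fun r hr => ?_
  have hr : 0 < r := hr
  rw [mul_right_comm, mul_right_comm (ENNReal.ofReal _), ← mul_assoc, mul_right_comm,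
    ← mul_assoc, ← ENNReal.ofReal_mul hr.le, ← ENNReal.ofReal_mul (by positivity),
    ← ENNReal.ofReal_mul (by positivity)]
  congr 2
  field_simp
  ring

/-! ### The law of a channel vector -/

/-- The law of a channel vector with two independent `CN(0,1)` entries. -/
noncomputable def channelLaw : Measure (EuclideanSpace ℂ (Fin 2)) :=
  (Measure.pi fun _ : Fin 2 => stdComplexGaussian).map (WithLp.toLp 2)

instance : IsProbabilityMeasure channelLaw :=
  Measure.isProbabilityMeasure_map (by fun_prop)

lemma charFun_channelLaw (t : EuclideanSpace ℂ (Fin 2)) :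
    charFun channelLaw t = Complex.exp (-(‖t‖ : ℂ) ^ 2 / 4) := by
  have h2 : (‖t‖ : ℂ) ^ 2 = (‖t 0‖ : ℂ) ^ 2 + (‖t 1‖ : ℂ) ^ 2 := by
    exact_mod_cast (by rw [EuclideanSpace.norm_sq_eq, Fin.sum_univ_two] :
      ‖t‖ ^ 2 = ‖t 0‖ ^ 2 + ‖t 1‖ ^ 2)
  rw [channelLaw, charFun_pi, Fin.prod_univ_two, charFun_stdComplexGaussian,
    charFun_stdComplexGaussian, ← Complex.exp_add, h2]
  congr 1
  ring

/-- Each real coordinate has variance `1/2`, hence the scaling by `1/√2`; both characteristic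
functions equal `exp(-‖t‖²/4)`. The purpose is to inherit the rotation invariance of `stdGaussian`.
-/
lemma channelLaw_eq_map_stdGaussian :
    channelLaw = (stdGaussian (EuclideanSpace ℂ (Fin 2))).map
      (fun x => (Real.sqrt 2)⁻¹ • x) := by
  have : IsFiniteMeasure ((stdGaussian (EuclideanSpace ℂ (Fin 2))).map
      (fun x => (Real.sqrt 2)⁻¹ • x)) := Measure.isFiniteMeasure_map _ _
  refine Measure.ext_of_charFun (funext fun t => ?_)
  rw [charFun_channelLaw, charFun_map_smul, charFun_stdGaussian, norm_smul, Real.norm_of_nonneg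
    (by positivity)]
  congr 1
  have : ((Real.sqrt 2)⁻¹ : ℂ) ^ 2 = 1 / 2 := by
    rw [inv_pow]
    rw [← Complex.ofReal_pow, Real.sq_sqrt (by norm_num)]
    norm_num
  push_cast
  rw [mul_pow, this]
  ring

/-- A complex isometry is in particular a real one, it commutes with real scaling, and the standard
Gaussian is invariant under real isometries. -/
lemma channelLaw_map_isometry
    (f : EuclideanSpace ℂ (Fin 2) ≃ₗᵢ[ℂ] EuclideanSpace ℂ (Fin 2)) :
    channelLaw.map f = channelLaw := by
  let f' : EuclideanSpace ℂ (Fin 2) ≃ₗᵢ[ℝ] EuclideanSpace ℂ (Fin 2) :=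
    { f.toLinearEquiv.restrictScalars ℝ with norm_map' := f.norm_map }
  have hf' : (f : EuclideanSpace ℂ (Fin 2) → EuclideanSpace ℂ (Fin 2)) = f' := rfl
  have hm : Measurable f' := f'.continuous.measurable
  have hs : Measurable fun x : EuclideanSpace ℂ (Fin 2) => (Real.sqrt 2)⁻¹ • x := by fun_prop
  rw [hf', channelLaw_eq_map_stdGaussian, Measure.map_map hm hs]
  have : f' ∘ (fun x => (Real.sqrt 2)⁻¹ • x) = (fun x => (Real.sqrt 2)⁻¹ • x) ∘ f' := by
    ext1 x
    simp
  rw [this, ← Measure.map_map hs hm, stdGaussian_map]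

/-- The law of the squared norm of a channel vector. -/
noncomputable def normSqLaw : Measure ℝ :=
  (volume.restrict (Set.Ioi 0)).withDensity fun t => ENNReal.ofReal (t * Real.exp (-t))

/-- The law of the squared correlation of a channel vector with a fixed direction. -/
noncomputable def unifLaw : Measure ℝ := volume.restrict (Set.Ioc 0 1)

instance : IsProbabilityMeasure unifLaw := ⟨by simp [unifLaw]⟩

instance : SFinite normSqLaw := by unfold normSqLaw; infer_instance

/-- The squared cosine of the angle between two channel vectors. -/
noncomputable def corr (w v : EuclideanSpace ℂ (Fin 2)) : ℝ :=
  ‖⟪w, v⟫_ℂ‖ ^ 2 / (‖w‖ ^ 2 * ‖v‖ ^ 2)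

lemma measurable_corr : Measurable fun p : EuclideanSpace ℂ (Fin 2) × EuclideanSpace ℂ (Fin 2) =>
    corr p.1 p.2 := by
  unfold corr
  fun_prop

lemma measurable_corr_right (w : EuclideanSpace ℂ (Fin 2)) : Measurable (corr w) := by
  unfold corr
  fun_prop

/-- If `a` and `b` are independent and exponentially distributed, then `a + b` and `a / (a + b)` are
independent, with laws `normSqLaw` and `unifLaw`. -/
lemma lintegral_exp_exp {F : ℝ × ℝ → ℝ≥0∞} (hF : Measurable F) :
    ∫⁻ a in Set.Ioi (0 : ℝ), ENNReal.ofReal (Real.exp (-a)) *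
        ∫⁻ b in Set.Ioi (0 : ℝ), ENNReal.ofReal (Real.exp (-b)) * F (a + b, a / (a + b))
      = ∫⁻ p, F p ∂(normSqLaw.prod unifLaw) := by
  -- Translation `t = a + b` for fixed `a`; the two exponentials merge into `e^{-t}`.
  have hshift : ∀ a : ℝ, ENNReal.ofReal (Real.exp (-a)) *
      ∫⁻ b in Set.Ioi (0 : ℝ), ENNReal.ofReal (Real.exp (-b)) * F (a + b, a / (a + b))
      = ∫⁻ t, (Set.Ioi a).indicator (fun t => ENNReal.ofReal (Real.exp (-t)) * F (t, a / t)) t := by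
    intro a
    rw [← lintegral_const_mul _ (by fun_prop), ← lintegral_indicator measurableSet_Ioi,
      ← lintegral_add_left_eq_self (fun t => (Set.Ioi a).indicator _ t) a]
    refine lintegral_congr fun b => ?_
    by_cases hb : 0 < b
    · rw [Set.indicator_of_mem (Set.mem_Ioi.2 hb),
        Set.indicator_of_mem (by simpa using hb), ← mul_assoc,
        ← ENNReal.ofReal_mul (Real.exp_nonneg _), ← Real.exp_add, neg_add]
    · rw [Set.indicator_of_notMem (by simpa using hb), Set.indicator_of_notMem (by simpa using hb)]
  simp_rw [hshift]
  have hmeas : Measurable (Function.uncurry fun a t : ℝ =>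
      (Set.Ioi a).indicator (fun t => ENNReal.ofReal (Real.exp (-t)) * F (t, a / t)) t) := by
    have : (Function.uncurry fun a t : ℝ =>
      (Set.Ioi a).indicator (fun t => ENNReal.ofReal (Real.exp (-t)) * F (t, a / t)) t)
        = {p : ℝ × ℝ | p.1 < p.2}.indicator
          (fun p => ENNReal.ofReal (Real.exp (-p.2)) * F (p.2, p.1 / p.2)) := by
      ext ⟨a, t⟩
      simp [Function.uncurry, Set.indicator]
    rw [this]
    exact Measurable.indicator (by fun_prop) (measurableSet_lt measurable_fst measurable_snd)
  rw [lintegral_lintegral_swap hmeas.aemeasurable, lintegral_prod _ hF.aemeasurable, normSqLaw,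
    lintegral_withDensity_eq_lintegral_mul _ (by fun_prop)
      (Measurable.lintegral_prod_right' hF), ← lintegral_indicator measurableSet_Ioi]
  refine lintegral_congr fun t => ?_
  rw [← lintegral_indicator measurableSet_Ioi]
  by_cases ht : 0 < t
  swap
  · rw [Set.indicator_of_notMem (by simpa using ht)]
    refine (lintegral_congr fun a => ?_).trans lintegral_zero
    by_cases ha : 0 < a
    · rw [Set.indicator_of_mem (Set.mem_Ioi.2 ha), Set.indicator_of_notMem]
      simp only [Set.mem_Ioi, not_lt] at ht ⊢
      linarith
    · rw [Set.indicator_of_notMem (by simpa using ha)]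
  rw [Set.indicator_of_mem (Set.mem_Ioi.2 ht), Pi.mul_apply, unifLaw,
    ENNReal.ofReal_mul ht.le, mul_assoc, ← lintegral_indicator measurableSet_Ioc]
  -- Dilation `v = a / t`; its Jacobian `t` is the factor that turns `e^{-t}` into the density of
  -- `normSqLaw`.
  have hscale : ∀ G : ℝ → ℝ≥0∞, Measurable G →
      ENNReal.ofReal t * ∫⁻ v, G v = ∫⁻ a, G (a / t) := by
    intro G hG
    have h := Real.map_volume_mul_right (a := t⁻¹) (inv_ne_zero ht.ne')
    have h2 : ∫⁻ a, G (a / t) = ∫⁻ v, G v ∂(Measure.map (· * t⁻¹) volume) := by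
      rw [lintegral_map hG (by fun_prop)]
      simp_rw [div_eq_mul_inv]
    rw [h2, h, inv_inv, abs_of_pos ht, lintegral_smul_measure, smul_eq_mul]
  have hG : Measurable ((Set.Ioc (0 : ℝ) 1).indicator fun v => F (t, v)) :=
    Measurable.indicator (by fun_prop) measurableSet_Ioc
  rw [mul_left_comm, hscale _ hG,
    ← lintegral_const_mul _ (by fun_prop)]
  -- The point `a = t` lies outside `a < t` although `v = 1` belongs to `Ioc 0 1`; it is a null set.
  have hae : ∀ᵐ a : ℝ, a ≠ t := by
    simp [ae_iff]
  refine lintegral_congr_ae (hae.mono fun a hat => ?_)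
  simp only
  by_cases ha : 0 < a
  · rw [Set.indicator_of_mem (Set.mem_Ioi.2 ha)]
    by_cases h2 : a < t
    · rw [Set.indicator_of_mem (Set.mem_Ioi.2 h2), Set.indicator_of_mem]
      exact ⟨by positivity, (div_le_one ht).2 h2.le⟩
    · rw [Set.indicator_of_notMem (by simpa using h2), Set.indicator_of_notMem, mul_zero]
      rw [Set.mem_Ioc, div_le_one ht]
      intro h3
      exact h2 (lt_of_le_of_ne h3.2 hat)
  · rw [Set.indicator_of_notMem (by simpa using ha), Set.indicator_of_notMem, mul_zero]
    intro h3
    exact ha ((div_pos_iff_of_pos_right ht).1 h3.1)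

lemma lintegral_channelLaw {F : ℝ × ℝ → ℝ≥0∞} (hF : Measurable F) :
    ∫⁻ x : EuclideanSpace ℂ (Fin 2), F (‖x‖ ^ 2, ‖x 0‖ ^ 2 / ‖x‖ ^ 2) ∂channelLaw
      = ∫⁻ p, F p ∂(normSqLaw.prod unifLaw) := by
  rw [channelLaw, lintegral_map (by fun_prop) (by fun_prop)]
  have h1 : ∀ x : Fin 2 → ℂ, F (‖(WithLp.toLp 2 x : EuclideanSpace ℂ (Fin 2))‖ ^ 2,
      ‖(WithLp.toLp 2 x : EuclideanSpace ℂ (Fin 2)) 0‖ ^ 2 /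
        ‖(WithLp.toLp 2 x : EuclideanSpace ℂ (Fin 2))‖ ^ 2)
      = (fun z : ℂ × ℂ => F (‖z.1‖ ^ 2 + ‖z.2‖ ^ 2, ‖z.1‖ ^ 2 / (‖z.1‖ ^ 2 + ‖z.2‖ ^ 2)))
        (MeasurableEquiv.finTwoArrow x) := by
    intro x
    simp [EuclideanSpace.norm_sq_eq, Fin.sum_univ_two, MeasurableEquiv.finTwoArrow]
  simp_rw [h1]
  rw [(measurePreserving_finTwoArrow stdComplexGaussian).lintegral_comp
      (f := fun z : ℂ × ℂ => F (‖z.1‖ ^ 2 + ‖z.2‖ ^ 2, ‖z.1‖ ^ 2 / (‖z.1‖ ^ 2 + ‖z.2‖ ^ 2)))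
      (by fun_prop),
    lintegral_prod _ (by fun_prop), ← lintegral_exp_exp hF]
  have h2 : ∀ a : ℝ, ∫⁻ y, F (a + ‖y‖ ^ 2, a / (a + ‖y‖ ^ 2)) ∂stdComplexGaussian
      = ∫⁻ b in Set.Ioi (0 : ℝ), ENNReal.ofReal (Real.exp (-b)) * F (a + b, a / (a + b)) := by
    intro a
    exact lintegral_normSq_stdComplexGaussian (f := fun b => F (a + b, a / (a + b)))
      (by fun_prop)
  simp_rw [h2]
  refine lintegral_normSq_stdComplexGaussian (f := fun a => ∫⁻ b in Set.Ioi (0 : ℝ),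
    ENNReal.ofReal (Real.exp (-b)) * F (a + b, a / (a + b))) ?_
  exact Measurable.lintegral_prod_right' (f := fun p : ℝ × ℝ =>
    ENNReal.ofReal (Real.exp (-p.2)) * F (p.1 + p.2, p.1 / (p.1 + p.2))) (by fun_prop)

/-- The squared norm of a channel vector and its squared correlation with a fixed nonzero vector are
independent. -/
lemma channelLaw_map_norm_corr {w : EuclideanSpace ℂ (Fin 2)} (hw : w ≠ 0) :
    channelLaw.map (fun x => (‖x‖ ^ 2, corr w x)) = normSqLaw.prod unifLaw := by
  have hmeas : Measurable fun x : EuclideanSpace ℂ (Fin 2) => (‖x‖ ^ 2, corr w x) :=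
    Measurable.prodMk (by fun_prop) (measurable_corr_right w)
  refine Measure.ext_of_lintegral _ fun F hF => ?_
  rw [lintegral_map hF hmeas, ← lintegral_channelLaw hF]
  set u : EuclideanSpace ℂ (Fin 2) := ((‖w‖⁻¹ : ℝ) : ℂ) • w with hu
  have hunorm : ‖u‖ = 1 := by
    rw [hu, norm_smul, Complex.norm_real, norm_inv, norm_norm,
      inv_mul_cancel₀ (norm_ne_zero_iff.2 hw)]
  -- In an orthonormal basis whose first vector is `w/‖w‖`, the correlation with `w` is the share of
  -- the first coordinate in the squared norm. Rotation invariance then reduces to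
  -- `lintegral_channelLaw`.
  obtain ⟨b, hb⟩ := Orthonormal.exists_orthonormalBasis_extension_of_card_eq (𝕜 := ℂ)
    (E := EuclideanSpace ℂ (Fin 2)) (ι := Fin 2) (by simp) (v := fun _ => u) (s := {0})
    ⟨fun i => by simpa using hunorm, fun i j hij => absurd (Subsingleton.elim i j) hij⟩
  have hb0 : b 0 = u := hb 0 rfl
  conv_rhs => rw [← channelLaw_map_isometry b.repr]
  rw [lintegral_map (by fun_prop) b.repr.continuous.measurable]
  refine lintegral_congr fun x => ?_
  rw [b.repr.norm_map, b.repr_apply_apply, hb0, hu, inner_smul_left, norm_mul, mul_pow]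
  congr 2
  have : ‖w‖ ≠ 0 := norm_ne_zero_iff.2 hw
  simp only [corr, Complex.conj_ofReal, Complex.norm_real, norm_inv, norm_norm, inv_pow]
  rw [div_mul_eq_div_div, div_eq_inv_mul (‖⟪w, x⟫_ℂ‖ ^ 2)]

lemma channelLaw_map_norm : channelLaw.map (fun x => ‖x‖ ^ 2) = normSqLaw := by
  have hw : (EuclideanSpace.single 0 1 : EuclideanSpace ℂ (Fin 2)) ≠ 0 := by
    simp
  have h := congrArg (fun m => m.map Prod.fst) (channelLaw_map_norm_corr hw)
  rw [Measure.map_map measurable_fst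
    (Measurable.prodMk (by fun_prop) (measurable_corr_right _)), Measure.map_fst_prod] at h
  simpa [Function.comp_def] using h

instance : IsProbabilityMeasure normSqLaw := by
  rw [← channelLaw_map_norm]
  exact Measure.isProbabilityMeasure_map (by fun_prop)

lemma channelLaw_ne_zero : ∀ᵐ x ∂channelLaw, x ≠ 0 := by
  have h : ∀ᵐ t ∂normSqLaw, t ≠ 0 := by
    refine (withDensity_absolutelyContinuous _ _).ae_le ?_
    filter_upwards [ae_restrict_mem measurableSet_Ioi] with t ht
    exact ne_of_gt ht
  rw [← channelLaw_map_norm] at h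
  filter_upwards [ae_of_ae_map (by fun_prop) h] with x hx
  rintro rfl
  simp at hx

/-! ### The joint law of the channels -/

lemma measurable_channel {Ω : Type*} [MeasurableSpace Ω] {h : Ω → EuclideanSpace ℂ (Fin 2)}
    (hmeas : ∀ a : Fin 2, Measurable fun ω => h ω a) : Measurable h :=
  (MeasurableEquiv.toLp 2 (Fin 2 → ℂ)).measurable.comp (measurable_pi_lambda _ hmeas)

lemma map_channels {Ω : Type*} [MeasurableSpace Ω] {μ : Measure Ω} [IsProbabilityMeasure μ]
    {K : ℕ} {h : Fin K → Ω → EuclideanSpace ℂ (Fin 2)}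
    (hmeas : ∀ (k : Fin K) (a : Fin 2), Measurable (fun ω => h k ω a))
    (hlaw : ∀ (k : Fin K) (a : Fin 2), μ.map (fun ω => h k ω a) = stdComplexGaussian)
    (hindep : iIndepFun (fun (p : Fin K × Fin 2) (ω : Ω) => h p.1 ω p.2) μ) :
    μ.map (fun ω k => h k ω) = Measure.pi fun _ : Fin K => channelLaw := by
  have h1 := (iIndepFun_iff_map_fun_eq_pi_map
    (fun p : Fin K × Fin 2 => (hmeas p.1 p.2).aemeasurable)).1 hindep
  simp_rw [hlaw] at h1
  have h2 := Measure.infinitePi_map_curry (fun (_ : Fin K) (_ : Fin 2) => stdComplexGaussian)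
  simp_rw [Measure.infinitePi_eq_pi] at h2
  have h3 : (fun ω k => h k ω) = (fun (x : Fin K → Fin 2 → ℂ) k => WithLp.toLp 2 (x k)) ∘
      (MeasurableEquiv.curry (Fin K) (Fin 2) ℂ) ∘ fun ω (p : Fin K × Fin 2) => h p.1 ω p.2 := by
    ext ω k a
    rfl
  have hm : Measurable fun ω (p : Fin K × Fin 2) => h p.1 ω p.2 :=
    measurable_pi_lambda _ fun p => hmeas p.1 p.2
  have hm2 : Measurable fun (x : Fin K → Fin 2 → ℂ) k =>
      (WithLp.toLp 2 (x k) : EuclideanSpace ℂ (Fin 2)) := by fun_prop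
  have hc := (MeasurableEquiv.curry (Fin K) (Fin 2) ℂ).measurable
  rw [h3, ← Measure.map_map hm2 (hc.comp hm), ← Measure.map_map hc hm, h1, h2]
  have hm3 : Measurable fun x : Fin 2 → ℂ => (WithLp.toLp 2 x : EuclideanSpace ℂ (Fin 2)) := by
    fun_prop
  have hpi := Measure.pi_map_pi
    (μ := fun _ : Fin K => Measure.pi fun _ : Fin 2 => stdComplexGaussian)
    (f := fun _ x => (WithLp.toLp 2 x : EuclideanSpace ℂ (Fin 2)))
    (hμ := fun _ => (inferInstance : SigmaFinite channelLaw)) (fun _ => hm3.aemeasurable)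
  exact hpi

/-! ### Integrals over finite products -/

lemma lintegral_pi_prod {ι : Type*} [Fintype ι] {X : Type*} [MeasurableSpace X]
    (ν : Measure X) [IsProbabilityMeasure ν] {f : ι → X → ℝ≥0∞} (hf : ∀ i, Measurable (f i)) :
    ∫⁻ x, ∏ i, f i (x i) ∂(Measure.pi fun _ : ι => ν) = ∏ i, ∫⁻ y, f i y ∂ν := by
  rw [lintegral_prod_eq_prod_lintegral_of_indepFun Finset.univ (fun i (x : ι → X) => f i (x i))
    (iIndepFun_pi fun i => (hf i).aemeasurable) (by fun_prop)]
  refine Finset.prod_congr rfl fun i _ => ?_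
  exact (measurePreserving_eval (fun _ : ι => ν) i).lintegral_comp (hf i)

lemma lintegral_pi_succAbove {n : ℕ} {X : Type*} [MeasurableSpace X]
    (ν : Measure X) [IsProbabilityMeasure ν] (p : Fin (n + 1)) {f : (Fin (n + 1) → X) → ℝ≥0∞}
    (hf : Measurable f) :
    ∫⁻ x, f x ∂(Measure.pi fun _ => ν)
      = ∫⁻ w, ∫⁻ y, f (p.insertNth w y) ∂(Measure.pi fun _ : Fin n => ν) ∂ν := by
  have h := (measurePreserving_piFinSuccAbove (fun _ : Fin (n + 1) => ν) p).symm
  have h2 := lintegral_prod (μ := ν) (ν := Measure.pi fun _ : Fin n => ν) _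
    (hf.comp h.measurable).aemeasurable
  exact (h.lintegral_comp hf).symm.trans h2

lemma measurable_insertNth {n : ℕ} {X Y : Type*} [MeasurableSpace X] [MeasurableSpace Y]
    (p : Fin (n + 1)) {f : Y → X} {g : Y → Fin n → X} (hf : Measurable f) (hg : Measurable g) :
    Measurable fun y => (p.insertNth (f y) (g y) : Fin (n + 1) → X) := by
  have h := (MeasurableEquiv.piFinSuccAbove (fun _ : Fin (n + 1) => X) p).symm.measurable
  exact h.comp (hf.prodMk hg)

/-- Integrating a function of `x k` times a product of functions of `x k` and `x j`, `j ≠ k`. -/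
lemma lintegral_pi_prod_erase {K : ℕ} {X : Type*} [MeasurableSpace X]
    (ν : Measure X) [IsProbabilityMeasure ν] (k : Fin K) {F : X → ℝ≥0∞} (hF : Measurable F)
    {φ : Fin K → X → X → ℝ≥0∞} (hφ : ∀ j, Measurable fun p : X × X => φ j p.1 p.2) :
    ∫⁻ x, F (x k) * ∏ j ∈ Finset.univ.erase k, φ j (x k) (x j) ∂(Measure.pi fun _ => ν)
      = ∫⁻ t, F t * ∏ j ∈ Finset.univ.erase k, ∫⁻ s, φ j t s ∂ν ∂ν := by
  obtain _ | n := K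
  · exact k.elim0
  have hφ1 : ∀ j t, Measurable (φ j t) := fun j t =>
    (hφ j).comp (g := fun p : X × X => φ j p.1 p.2) (f := fun s => (t, s)) (by fun_prop)
  have hprod : ∀ f : Fin (n + 1) → ℝ≥0∞,
      ∏ j ∈ Finset.univ.erase k, f j = ∏ j : Fin n, f (k.succAbove j) := by
    intro f
    have h1 : Finset.univ.erase k = Finset.univ.map (Fin.succAboveEmb k) := by
      ext j
      simp only [Finset.mem_erase, Finset.mem_univ, and_true, Finset.mem_map, true_and,
        Fin.coe_succAboveEmb]
      exact Fin.exists_succAbove_eq_iff.symm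
    rw [h1, Finset.prod_map]
    rfl
  have hmeas : Measurable fun x : Fin (n + 1) → X =>
      F (x k) * ∏ j ∈ Finset.univ.erase k, φ j (x k) (x j) :=
    (hF.comp (measurable_pi_apply k)).mul (Finset.measurable_prod _ fun j _ =>
      (hφ j).comp (g := fun p : X × X => φ j p.1 p.2) (f := fun x : Fin (n + 1) → X => (x k, x j))
        ((measurable_pi_apply k).prodMk (measurable_pi_apply j)))
  rw [lintegral_pi_succAbove ν k hmeas]
  refine lintegral_congr fun t => ?_
  simp_rw [hprod, Fin.insertNth_apply_same, Fin.insertNth_apply_succAbove]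
  have hm2 : Measurable fun y : Fin n → X => ∏ j, φ (k.succAbove j) t (y j) :=
    Finset.measurable_prod _ fun j _ => (hφ1 _ t).comp (measurable_pi_apply j)
  rw [lintegral_const_mul _ hm2,
    lintegral_pi_prod ν (f := fun j => φ (k.succAbove j) t) fun j => hφ1 _ t]

/-- A function of the squared norms of independent channels and of their correlations with the
channel `p` has the same mean as if the correlations were independent of each other and of the
norms. -/
lemma lintegral_norm_corr {K : ℕ} (p : Fin K) {G : (Fin K → ℝ) × (Fin K → ℝ) → ℝ≥0∞}
    (hG : Measurable G)
    (hdep : ∀ T V V', (∀ j, j ≠ p → V j = V' j) → G (T, V) = G (T, V')) :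
    ∫⁻ x, G (fun j => ‖x j‖ ^ 2, fun j => corr (x p) (x j))
        ∂(Measure.pi fun _ : Fin K => channelLaw)
      = ∫⁻ T, ∫⁻ V, G (T, V) ∂(Measure.pi fun _ => unifLaw) ∂(Measure.pi fun _ => normSqLaw) := by
  obtain _ | n := K
  · exact p.elim0
  have hGm : Measurable fun x : Fin (n + 1) → EuclideanSpace ℂ (Fin 2) =>
      G (fun j => ‖x j‖ ^ 2, fun j => corr (x p) (x j)) := by
    have hm1 : Measurable fun (x : Fin (n + 1) → EuclideanSpace ℂ (Fin 2)) j => ‖x j‖ ^ 2 := by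
      fun_prop
    have hm2 : Measurable fun (x : Fin (n + 1) → EuclideanSpace ℂ (Fin 2)) j =>
        corr (x p) (x j) := measurable_pi_lambda _ fun j =>
      measurable_corr.comp (f := fun x : Fin (n + 1) → EuclideanSpace ℂ (Fin 2) => (x p, x j))
        ((measurable_pi_apply p).prodMk (measurable_pi_apply j))
    exact hG.comp (hm1.prodMk hm2)
  -- The `p`-th correlation slot is filled with a dummy `0`, which `hdep` permits. Both sides of the
  -- claim are then reduced to the integral of `H`.
  set H : ℝ → (Fin n → ℝ × ℝ) → ℝ≥0∞ := fun t z =>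
    G (p.insertNth t fun j => (z j).1, p.insertNth 0 fun j => (z j).2) with hH
  have hHm : Measurable fun q : ℝ × (Fin n → ℝ × ℝ) => H q.1 q.2 :=
    hG.comp ((measurable_insertNth p (by fun_prop) (by fun_prop)).prodMk
      (measurable_insertNth p (by fun_prop) (by fun_prop)))
  have hHm1 : ∀ t, Measurable (H t) := fun t =>
    hHm.comp (f := fun z => (t, z)) (by fun_prop)
  have hHm2 : Measurable fun t => ∫⁻ z, H t z ∂(Measure.pi fun _ => normSqLaw.prod unifLaw) :=
    Measurable.lintegral_prod_right' hHm
  trans ∫⁻ t, ∫⁻ z, H t z ∂(Measure.pi fun _ => normSqLaw.prod unifLaw) ∂normSqLaw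
  · rw [lintegral_pi_succAbove channelLaw p hGm, ← channelLaw_map_norm,
      lintegral_map (by rw [channelLaw_map_norm]; exact hHm2) (by fun_prop)]
    rw [channelLaw_map_norm]
    refine lintegral_congr_ae (channelLaw_ne_zero.mono fun w hw => ?_)
    dsimp only
    have hmap := channelLaw_map_norm_corr hw
    have hmm : Measurable fun x : EuclideanSpace ℂ (Fin 2) => (‖x‖ ^ 2, corr w x) :=
      Measurable.prodMk (by fun_prop) (measurable_corr_right w)
    have hpi := Measure.pi_map_pi (μ := fun _ : Fin n => channelLaw)
      (f := fun _ x => (‖x‖ ^ 2, corr w x))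
      (hμ := fun _ => by rw [hmap]; infer_instance) (fun _ => hmm.aemeasurable)
    have hmp : Measurable fun (x : Fin n → EuclideanSpace ℂ (Fin 2)) i =>
        (‖x i‖ ^ 2, corr w (x i)) :=
      measurable_pi_lambda _ fun i => hmm.comp (measurable_pi_apply i)
    rw [← hmap, ← hpi, lintegral_map (hHm1 _) hmp]
    refine lintegral_congr fun y => ?_
    rw [hH]
    dsimp only
    have e1 : (fun j => ‖(p.insertNth w y : Fin (n + 1) → EuclideanSpace ℂ (Fin 2)) j‖ ^ 2)
        = p.insertNth (‖w‖ ^ 2) fun j => ‖y j‖ ^ 2 := by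
      ext j
      induction j using p.succAboveCases <;> simp
    rw [e1]
    refine hdep _ _ _ fun j hj => ?_
    obtain ⟨i, rfl⟩ := Fin.exists_succAbove_eq hj
    simp
  · have harrow := measurePreserving_arrowProdEquivProdArrow ℝ ℝ (Fin (n + 1))
      (fun _ => normSqLaw) (fun _ => unifLaw)
    have hsucc := lintegral_pi_succAbove (normSqLaw.prod unifLaw) p (hG.comp harrow.measurable)
    simp only [Function.comp_def] at hsucc
    rw [← lintegral_prod _ hG.aemeasurable, ← harrow.lintegral_comp hG, hsucc]
    rw [lintegral_prod]
    · refine lintegral_congr fun t => ?_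
      -- The uniform variable in slot `p` is not used by `H`; integrating it out contributes the
      -- factor `1`.
      rw [← one_mul (∫⁻ z, H t z ∂_), mul_comm, ← measure_univ (μ := unifLaw), ← lintegral_const]
      refine lintegral_congr fun v => lintegral_congr fun z => ?_
      rw [hH]
      change _ = G (fun j => ((p.insertNth (t, v) z : Fin (n + 1) → ℝ × ℝ) j).1,
        fun j => ((p.insertNth (t, v) z : Fin (n + 1) → ℝ × ℝ) j).2)
      have e1 : (fun j => ((p.insertNth (t, v) z : Fin (n + 1) → ℝ × ℝ) j).1)
          = p.insertNth t fun j => (z j).1 := by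
        ext j
        induction j using p.succAboveCases <;> simp
      rw [e1]
      refine hdep _ _ _ fun j hj => ?_
      obtain ⟨i, rfl⟩ := Fin.exists_succAbove_eq hj
      simp
    · refine (Measurable.lintegral_prod_right' (f := fun q : (ℝ × ℝ) × (Fin n → ℝ × ℝ) =>
        G (MeasurableEquiv.arrowProdEquivProdArrow ℝ ℝ (Fin (n + 1)) (p.insertNth q.1 q.2)))
        ?_).aemeasurable
      exact (hG.comp harrow.measurable).comp (measurable_insertNth p (by fun_prop) (by fun_prop))

/-! ### Absence of ties -/

instance : NullSingletonClass normSqLaw := by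
  unfold normSqLaw
  infer_instance

/-- Fix two users and condition on the norm of one: a tie forces the norm of the other to take a
single value, and `normSqLaw` has no atoms. -/
lemma ae_gain_injective {K : ℕ} {g : Fin K → ℝ} (hg : ∀ k, 0 < g k) :
    ∀ᵐ T ∂(Measure.pi fun _ : Fin K => normSqLaw), Function.Injective fun k => g k * T k := by
  have h : ∀ k j : Fin K, j ≠ k → ∀ᵐ T ∂(Measure.pi fun _ : Fin K => normSqLaw),
      g k * T k ≠ g j * T j := by
    intro k j hkj
    rw [ae_iff]
    have hms : MeasurableSet {p : ℝ × ℝ | g k * p.1 = g j * p.2} :=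
      measurableSet_eq_fun (by fun_prop) (by fun_prop)
    have hmT : MeasurableSet {T : Fin K → ℝ | ¬ g k * T k ≠ g j * T j} := by
      simp only [not_not]
      exact measurableSet_eq_fun (by fun_prop) (by fun_prop)
    set D : ℝ → ℝ → ℝ≥0∞ := fun t s =>
      {p : ℝ × ℝ | g k * p.1 = g j * p.2}.indicator (fun _ => 1) (t, s) with hD
    have e := lintegral_pi_prod_erase normSqLaw k (F := fun _ => 1) measurable_const
      (φ := fun i t s => if i = j then D t s else 1) (fun i => by
        by_cases hi : i = j
        · simp only [hi, if_true]
          exact measurable_const.indicator hms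
        · simp only [hi, if_false]
          exact measurable_const)
    have hjm : j ∈ Finset.univ.erase k := by simp [hkj]
    simp only [one_mul] at e
    rw [← lintegral_indicator_one hmT]
    have e2 : ∀ T : Fin K → ℝ, ∏ i ∈ Finset.univ.erase k, (if i = j then D (T k) (T i) else 1)
        = {T : Fin K → ℝ | ¬ g k * T k ≠ g j * T j}.indicator 1 T := by
      intro T
      rw [Finset.prod_ite_eq' _ j (fun i => D (T k) (T i)), if_pos hjm]
      simp [hD, Set.indicator]
    simp_rw [e2] at e
    rw [e]
    refine (lintegral_congr fun t => ?_).trans lintegral_zero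
    refine Finset.prod_eq_zero hjm ?_
    simp only [if_true]
    have e3 : ∀ s, D t s = ({g k * t / g j} : Set ℝ).indicator 1 s := by
      intro s
      have : g k * t = g j * s ↔ s = g k * t / g j := by
        rw [eq_div_iff (hg j).ne', mul_comm (g j), eq_comm]
      simp [hD, Set.indicator, this]
    simp_rw [e3]
    rw [lintegral_indicator_one (measurableSet_singleton _), measure_singleton]
  have h2 : ∀ᵐ T ∂(Measure.pi fun _ : Fin K => normSqLaw),
      ∀ k j : Fin K, j ≠ k → g k * T k ≠ g j * T j := by
    simp only [ae_all_iff]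
    exact h
  filter_upwards [h2] with T hT k j hkj
  by_contra hne
  exact hT k j (Ne.symm hne) hkj

lemma ae_channels_generic {K : ℕ} {g : Fin K → ℝ} (hg : ∀ k, 0 < g k) :
    ∀ᵐ x ∂(Measure.pi fun _ : Fin K => channelLaw),
      (∀ k, x k ≠ 0) ∧ Function.Injective (gain g x) := by
  have h1 : ∀ᵐ x ∂(Measure.pi fun _ : Fin K => channelLaw), ∀ k, x k ≠ 0 := by
    rw [ae_all_iff]
    exact fun k => (Measure.tendsto_eval_ae_ae (μ := fun _ : Fin K => channelLaw)
      (i := k)).eventually channelLaw_ne_zero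
  have hpi := Measure.pi_map_pi (μ := fun _ : Fin K => channelLaw)
    (f := fun _ x => ‖x‖ ^ 2)
    (hμ := fun _ => by rw [channelLaw_map_norm]; infer_instance)
    (fun _ => Measurable.aemeasurable (by fun_prop))
  have h2 := ae_gain_injective hg
  rw [← channelLaw_map_norm, ← hpi] at h2
  have hm : Measurable fun (x : Fin K → EuclideanSpace ℂ (Fin 2)) j => ‖x j‖ ^ 2 := by
    fun_prop
  filter_upwards [h1, ae_of_ae_map hm.aemeasurable h2] with x hx1 hx2
  exact ⟨hx1, hx2⟩

variable {K : ℕ}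

/-! ### The SINR of the second user of a pair -/

/-- The SINR of a user with normalised gain `x` that is served together with one other user, to
whose channel it has squared correlation `v`. -/
noncomputable def pairSinr (l : Beamforming) (x v : ℝ) : ℝ :=
  match l with
  | Beamforming.MRT => x / (1 + x * v)
  | Beamforming.ZF => x * (1 - v)

lemma corr_nonneg (w v : EuclideanSpace ℂ (Fin 2)) : 0 ≤ corr w v := by
  unfold corr
  positivity

lemma norm_inner_sq_eq_corr {w v : EuclideanSpace ℂ (Fin 2)} (hw : w ≠ 0) (hv : v ≠ 0) :
    ‖⟪w, v⟫_ℂ‖ ^ 2 = corr w v * (‖w‖ ^ 2 * ‖v‖ ^ 2) := by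
  have h1 : ‖w‖ ≠ 0 := norm_ne_zero_iff.2 hw
  have h2 : ‖v‖ ≠ 0 := norm_ne_zero_iff.2 hv
  rw [corr]
  field_simp

lemma norm_inner_normalize_sq (u d : EuclideanSpace ℂ (Fin 2)) :
    ‖⟪u, (‖d‖)⁻¹ • d⟫_ℂ‖ ^ 2 = ‖⟪u, d⟫_ℂ‖ ^ 2 / ‖d‖ ^ 2 := by
  rw [← algebraMap_smul ℂ (‖d‖)⁻¹ d, inner_smul_right, norm_mul, mul_pow]
  simp [div_eq_inv_mul]

lemma norm_sq_starProjection_orthogonal_singleton {w v : EuclideanSpace ℂ (Fin 2)} (hw : w ≠ 0)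
    (hv : v ≠ 0) :
    ‖(Submodule.span ℂ {w})ᗮ.starProjection v‖ ^ 2 = ‖v‖ ^ 2 * (1 - corr w v) := by
  have h1 : ‖w‖ ≠ 0 := norm_ne_zero_iff.2 hw
  have h := Submodule.norm_sq_eq_add_norm_sq_starProjection v (Submodule.span ℂ {w})
  have h2 : ‖(Submodule.span ℂ {w}).starProjection v‖ ^ 2 = corr w v * ‖v‖ ^ 2 := by
    rw [Submodule.starProjection_singleton, norm_smul, mul_pow, norm_div, div_pow,
      norm_inner_sq_eq_corr hw hv]
    simp
    field_simp
  linear_combination -h2 - h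

lemma norm_inner_starProjection (W : Submodule ℂ (EuclideanSpace ℂ (Fin 2)))
    (v : EuclideanSpace ℂ (Fin 2)) :
    ‖⟪v, W.starProjection v⟫_ℂ‖ = ‖W.starProjection v‖ ^ 2 := by
  have h : ⟪v, W.starProjection v⟫_ℂ = ⟪W.starProjection v, W.starProjection v⟫_ℂ := by
    rw [Submodule.inner_starProjection_left_eq_right,
      Submodule.starProjection_eq_self_iff.2 (W.starProjection_apply_mem v)]
  rw [h, inner_self_eq_norm_sq_to_K]
  simp

/-- With two served users `ρ = 1`, so the noise is `σ²`. For MRT the signal is `‖h_k‖²` and the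
interference is `‖h_k‖²` times the correlation. For ZF the beam of `p` is orthogonal to `h_k`, and
the signal is the squared length of the projection of `h_k`, that is `‖h_k‖²(1 - v)`. -/
lemma sinr_pair (l : Beamforming) {σ : ℝ} (hσ : 0 < σ) {g : Fin K → ℝ} (hg : ∀ k, 0 < g k)
    {x : Fin K → EuclideanSpace ℂ (Fin 2)} (hx : ∀ k, x k ≠ 0) {p k : Fin K} (hpk : k ≠ p) :
    sinr l σ g x {p, k} k = pairSinr l (g k * ‖x k‖ ^ 2 / σ ^ 2) (corr (x p) (x k)) := by
  have hnoise : effNoise σ ({p, k} : Finset (Fin K)) = σ ^ 2 := by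
    rw [effNoise, Finset.card_pair hpk.symm]
    norm_num
  have herase : ({p, k} : Finset (Fin K)).erase k = {p} := by
    ext j
    simp only [Finset.mem_erase, Finset.mem_insert, Finset.mem_singleton]
    constructor
    · tauto
    · rintro rfl
      exact ⟨hpk.symm, Or.inl rfl⟩
  have hxk : ‖x k‖ ≠ 0 := norm_ne_zero_iff.2 (hx k)
  have hxp : ‖x p‖ ≠ 0 := norm_ne_zero_iff.2 (hx p)
  have hgk : 0 < g k := hg k
  rw [sinr, hnoise, herase, Finset.sum_singleton]
  cases l with
  | MRT =>
    simp only [beam, beamDirection, pairSinr]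
    rw [norm_inner_normalize_sq, norm_inner_normalize_sq, norm_inner_symm (x k) (x p),
      norm_inner_sq_eq_corr (hx p) (hx k), inner_self_eq_norm_sq_to_K]
    have hden : σ ^ 2 + g k * (corr (x p) (x k) * ‖x k‖ ^ 2) ≠ 0 := by
      have := corr_nonneg (x p) (x k)
      positivity
    have hden2 : 1 + g k * ‖x k‖ ^ 2 / σ ^ 2 * corr (x p) (x k) ≠ 0 := by
      have := corr_nonneg (x p) (x k)
      positivity
    have e1 : ‖((‖x k‖ : ℝ) : ℂ) ^ 2‖ ^ 2 / ‖x k‖ ^ 2 = ‖x k‖ ^ 2 := by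
      simp
      field_simp
    have e2 : corr (x p) (x k) * (‖x p‖ ^ 2 * ‖x k‖ ^ 2) / ‖x p‖ ^ 2
        = corr (x p) (x k) * ‖x k‖ ^ 2 := by
      field_simp
    erw [e1]
    rw [e2]
    field_simp
  | ZF =>
    have hs1 : x '' {j | j ∈ ({p, k} : Finset (Fin K)) ∧ j ≠ k} = {x p} := by
      have : {j | j ∈ ({p, k} : Finset (Fin K)) ∧ j ≠ k} = {p} := by
        ext j
        simp only [Finset.mem_insert, Finset.mem_singleton, Set.mem_ofPred_eq,
          Set.mem_singleton_iff]
        constructor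
        · tauto
        · rintro rfl
          exact ⟨Or.inl rfl, hpk.symm⟩
      rw [this, Set.image_singleton]
    have hs2 : x k ∈ x '' {j | j ∈ ({p, k} : Finset (Fin K)) ∧ j ≠ p} :=
      ⟨k, by simp [hpk], rfl⟩
    have hzero : ⟪x k, beam Beamforming.ZF x {p, k} p⟫_ℂ = 0 := by
      rw [beam, ← algebraMap_smul ℂ, inner_smul_right]
      simp only [beamDirection]
      rw [(Submodule.mem_orthogonal _ _).1 (Submodule.starProjection_apply_mem _ _) (x k)
        (Submodule.subset_span hs2), mul_zero]
    rw [hzero]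
    simp only [beam, beamDirection, pairSinr]
    simp only [hs1]
    rw [norm_inner_normalize_sq, norm_inner_starProjection]
    have e1 := norm_sq_starProjection_orthogonal_singleton (hx p) (hx k)
    set N := ‖(Submodule.span ℂ {x p})ᗮ.starProjection (x k)‖ with hN
    -- The case `N = 0` is that of parallel channels, where the beam is the zero vector by the
    -- convention for `0⁻¹`.
    have e2 : (N ^ 2) ^ 2 / N ^ 2 = N ^ 2 := by
      by_cases h0 : N = 0
      · simp [h0]
      · field_simp
    rw [e2, e1]
    simp
    ring

/-! ### The selection of the users -/

/-- The contribution of the user `j` to the probability that `k` is selected after `p`, as a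
function of the correlation of `j` with `p`; the user `k` is weighted by `ψ`. -/
noncomputable def selFactor (α : ℝ) (a : Fin K → ℝ) (ψ : ℝ → ℝ≥0∞) (p k j : Fin K) (v : ℝ) :
    ℝ≥0∞ :=
  if j = p then 1 else if j = k then (if v ≤ α ^ 2 then ψ v else 0)
    else if a k < a j then (if α ^ 2 < v then 1 else 0) else 1

/-- The weight of the configurations in which `p` is selected first. -/
noncomputable def selWeight (α : ℝ) (ψ : ℝ → ℝ → ℝ≥0∞) (p : Fin K) (a V : Fin K → ℝ) : ℝ≥0∞ :=
  if ∀ j, j ≠ p → a j < a p then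
    ∑ k ∈ Finset.univ.erase p, ∏ j, selFactor α a (ψ (a k)) p k j (V j)
  else 0

lemma exists_strict_max {a : Fin K → ℝ} (hK : 0 < K) (ha : Function.Injective a) :
    ∃ p, ∀ j, j ≠ p → a j < a p := by
  have : Nonempty (Fin K) := ⟨⟨0, hK⟩⟩
  obtain ⟨p, hp⟩ := Finite.exists_max a
  exact ⟨p, fun j hj => lt_of_le_of_ne (hp j) fun h => hj (ha h)⟩

lemma sum_ite_max {a : Fin K → ℝ} {p : Fin K} (hp : ∀ j, j ≠ p → a j < a p)
    (f : Fin K → ℝ≥0∞) :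
    ∑ q, (if ∀ j, j ≠ q → a j < a q then f q else 0) = f p := by
  rw [Finset.sum_eq_single p, if_pos hp]
  · intro q _ hq
    rw [if_neg]
    intro h
    exact lt_asymm (hp q hq) (h p (Ne.symm hq))
  · simp

lemma firstUser_eq {g : Fin K → ℝ} {x : Fin K → EuclideanSpace ℂ (Fin 2)} {p : Fin K}
    (hp : ∀ j, j ≠ p → gain g x j < gain g x p) : firstUser g x = some p := by
  rw [firstUser, List.argmax_eq_some_iff]
  refine ⟨List.mem_finRange p, fun j _ => ?_, fun j _ hj => ?_⟩
  · by_cases h : j = p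
    · rw [h]
    · exact (hp j h).le
  · by_cases h : j = p
    · rw [h]
    · exact absurd hj (not_le.2 (hp j h))

lemma mem_candidates {α : ℝ} {x : Fin K → EuclideanSpace ℂ (Fin 2)} {p j : Fin K} :
    j ∈ candidates α x p ↔ j ≠ p ∧ corr (x p) (x j) ≤ α ^ 2 := by
  simp only [candidates, List.mem_filter, List.mem_finRange, true_and, decide_eq_true_eq]
  rfl

lemma secondUser_eq {α : ℝ} {g : Fin K → ℝ} {x : Fin K → EuclideanSpace ℂ (Fin 2)} {p : Fin K}
    (hp : ∀ j, j ≠ p → gain g x j < gain g x p) :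
    secondUser α g x = (candidates α x p).argmax (gain g x) := by
  rw [secondUser, firstUser_eq hp, Option.bind_some]

/-- Without ties, the guard in `selWeight` leaves only the true first user `p`, and at most one `k`
contributes. If `k` is selected, the term of another candidate `j` vanishes: either `j` fails the
test itself, or `j` is weaker than `k`, which passes. If nobody passes, all terms vanish. -/
lemma ofReal_secondUserRate (l : Beamforming) {σ α : ℝ} (hσ : 0 < σ) {g : Fin K → ℝ}
    (hg : ∀ k, 0 < g k) (hK : 0 < K) {x : Fin K → EuclideanSpace ℂ (Fin 2)} (hx : ∀ k, x k ≠ 0)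
    (hinj : Function.Injective (gain g x)) :
    ENNReal.ofReal (secondUserRate l σ α g x)
      = ∑ p, selWeight α (fun a v => ENNReal.ofReal (Real.log (1 + pairSinr l (a / σ ^ 2) v))) p
          (gain g x) (fun j => corr (x p) (x j)) := by
  obtain ⟨p, hp⟩ := exists_strict_max hK hinj
  simp only [selWeight]
  rw [sum_ite_max hp fun q => ∑ k ∈ Finset.univ.erase q, ∏ j, selFactor α (gain g x)
    (fun v => ENNReal.ofReal (Real.log (1 + pairSinr l (gain g x k / σ ^ 2) v))) q k j
      (corr (x q) (x j)), secondUserRate, secondUser_eq hp, firstUser_eq hp]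
  obtain hn | ⟨k, hk⟩ : (candidates α x p).argmax (gain g x) = none ∨
      ∃ k, (candidates α x p).argmax (gain g x) = some k := by
    cases h : (candidates α x p).argmax (gain g x) <;> simp
  · rw [hn, ENNReal.ofReal_zero, eq_comm]
    rw [List.argmax_eq_none] at hn
    refine Finset.sum_eq_zero fun k hk => Finset.prod_eq_zero (Finset.mem_univ k) ?_
    have hkp := Finset.ne_of_mem_erase hk
    have : ¬ corr (x p) (x k) ≤ α ^ 2 := fun h => by
      have := mem_candidates.2 ⟨hkp, h⟩
      simp [hn] at this
    simp [selFactor, hkp, this]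
  · rw [hk]
    dsimp only
    have hk' := List.argmax_eq_some_iff.1 hk
    obtain ⟨hkp, hkα⟩ := mem_candidates.1 hk'.1
    rw [sinr_pair l hσ hg hx hkp, Finset.sum_eq_single k]
    · rw [Finset.prod_eq_single k]
      · simp [selFactor, hkp, hkα, gain]
      · intro j _ hjk
        simp only [selFactor, if_neg hjk]
        split_ifs with h1 h2 h3
        · rfl
        · rfl
        · exact absurd (hk'.2.1 j (mem_candidates.2 ⟨h1, not_lt.1 h3⟩)) (not_le.2 h2)
        · rfl
      · simp
    · intro j hj hjk
      have hjp := Finset.ne_of_mem_erase hj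
      by_cases hjα : corr (x p) (x j) ≤ α ^ 2
      · have hlt : gain g x j < gain g x k :=
          lt_of_le_of_ne (hk'.2.1 j (mem_candidates.2 ⟨hjp, hjα⟩)) fun h => hjk (hinj h)
        refine Finset.prod_eq_zero (Finset.mem_univ k) ?_
        simp [selFactor, hkp, Ne.symm hjk, hlt, hkα]
      · refine Finset.prod_eq_zero (Finset.mem_univ j) ?_
        simp [selFactor, hjp, hjα]
    · simp [hkp]

/-- The indicator of the configurations in which `p` is selected first and no other user is
semi-orthogonal to `p`. -/
noncomputable def soloWeight (α : ℝ) (p : Fin K) (a V : Fin K → ℝ) : ℝ≥0∞ :=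
  if ∀ j, j ≠ p → a j < a p then
    ∏ j ∈ Finset.univ.erase p, (if α ^ 2 < V j then 1 else 0)
  else 0

lemma indicator_secondUser_isNone {α : ℝ} {g : Fin K → ℝ} (hK : 0 < K)
    {x : Fin K → EuclideanSpace ℂ (Fin 2)} (hinj : Function.Injective (gain g x)) :
    (if (secondUser α g x).isSome = true then 0 else 1)
      = ∑ p, soloWeight α p (gain g x) (fun j => corr (x p) (x j)) := by
  obtain ⟨p, hp⟩ := exists_strict_max hK hinj
  simp only [soloWeight]
  rw [sum_ite_max hp fun q => ∏ j ∈ Finset.univ.erase q,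
    (if α ^ 2 < corr (x q) (x j) then 1 else 0), secondUser_eq hp]
  by_cases hn : candidates α x p = []
  · rw [hn, Finset.prod_eq_one]
    · simp
    · intro j hj
      rw [if_pos]
      by_contra h
      have := mem_candidates.2 ⟨Finset.ne_of_mem_erase hj, not_lt.1 h⟩
      simp [hn] at this
  · rw [if_pos (Option.isSome_iff_ne_none.2 fun h => hn (List.argmax_eq_none.1 h))]
    obtain ⟨k, hk⟩ := List.exists_mem_of_ne_nil _ hn
    obtain ⟨hkp, hkα⟩ := mem_candidates.1 hk
    rw [Finset.prod_eq_zero (Finset.mem_erase.2 ⟨hkp, Finset.mem_univ k⟩)]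
    exact if_neg (not_lt.2 hkα)

/-! ### The function `Υ` as an integral over the correlation -/

lemma pairSinr_nonneg (l : Beamforming) {x v : ℝ} (hx : 0 < x) (hv0 : 0 ≤ v) (hv1 : v ≤ 1) :
    0 ≤ pairSinr l x v := by
  cases l with
  | MRT => exact div_nonneg hx.le (by positivity)
  | ZF => exact mul_nonneg hx.le (by linarith)

lemma pairSinr_le (l : Beamforming) {x v : ℝ} (hx : 0 < x) (hv0 : 0 ≤ v) :
    pairSinr l x v ≤ x := by
  cases l with
  | MRT => exact div_le_self hx.le (by nlinarith [mul_nonneg hx.le hv0])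
  | ZF => simp only [pairSinr]; nlinarith [mul_nonneg hx.le hv0]

lemma hasDerivAt_mul_log_sub {y : ℝ} (hy : y ≠ 0) :
    HasDerivAt (fun y => y * Real.log y - y) (Real.log y) y := by
  have h := ((hasDerivAt_id y).mul (Real.hasDerivAt_log hy)).sub (hasDerivAt_id y)
  refine h.congr_deriv ?_
  simp [hy]

lemma continuousOn_log_one_add_pairSinr (l : Beamforming) {x : ℝ} (hx : 0 < x) :
    ContinuousOn (fun v => Real.log (1 + pairSinr l x v)) (Set.Icc 0 1) := by
  refine ContinuousOn.log ?_ fun v hv =>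
    (add_pos_of_pos_of_nonneg one_pos (pairSinr_nonneg l hx hv.1 hv.2)).ne'
  refine continuousOn_const.add ?_
  cases l with
  | MRT =>
    refine continuousOn_const.div (by fun_prop) fun v hv => ?_
    have := mul_nonneg hx.le hv.1
    positivity
  | ZF =>
    exact (by fun_prop : Continuous fun v : ℝ => x * (1 - v)).continuousOn

lemma integral_log_one_add_pairSinr (l : Beamforming) {x α : ℝ} (hx : 0 < x) (hα0 : 0 < α)
    (hα1 : α ≤ 1) :
    ∫ v in (0 : ℝ)..α ^ 2, Real.log (1 + pairSinr l x v) = Upsilon l α x := by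
  have hα2 : α ^ 2 ≤ 1 := by nlinarith
  have hα2p : 0 ≤ α ^ 2 := sq_nonneg α
  have hint : IntervalIntegrable (fun v => Real.log (1 + pairSinr l x v)) volume 0 (α ^ 2) := by
    refine ContinuousOn.intervalIntegrable ((continuousOn_log_one_add_pairSinr l hx).mono ?_)
    rw [Set.uIcc_of_le hα2p]
    exact Set.Icc_subset_Icc_right hα2
  cases l with
  | MRT =>
    have hder : ∀ v ∈ Set.uIcc 0 (α ^ 2), HasDerivAt
        (fun v => 1 / x * (((1 + x + x * v) * Real.log (1 + x + x * v) - (1 + x + x * v))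
          - ((1 + x * v) * Real.log (1 + x * v) - (1 + x * v))))
        (Real.log (1 + pairSinr Beamforming.MRT x v)) v := by
      intro v hv
      rw [Set.uIcc_of_le hα2p] at hv
      have h0 : 0 ≤ x * v := mul_nonneg hx.le hv.1
      have h1 : 1 + x + x * v ≠ 0 := by positivity
      have h2 : 1 + x * v ≠ 0 := by positivity
      have e1 : HasDerivAt (fun v => 1 + x + x * v) x v := by
        simpa using ((hasDerivAt_id v).const_mul x).const_add (1 + x)
      have e2 : HasDerivAt (fun v => 1 + x * v) x v := by
        simpa using ((hasDerivAt_id v).const_mul x).const_add 1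
      have h := (((hasDerivAt_mul_log_sub h1).comp v e1).sub
        ((hasDerivAt_mul_log_sub h2).comp v e2)).const_mul (1 / x)
      refine h.congr_deriv ?_
      -- The logarithm splits into `log(1 + x + xv) - log(1 + xv)`, and both parts are integrated by
      -- `y log y - y`.
      have e3 : 1 + pairSinr Beamforming.MRT x v = (1 + x + x * v) / (1 + x * v) := by
        simp only [pairSinr]
        field_simp
        ring
      rw [e3, Real.log_div h1 h2]
      field_simp
    rw [intervalIntegral.integral_eq_sub_of_hasDerivAt hder hint]
    simp only [Upsilon]
    have hA : 0 < 1 + x + α ^ 2 * x := by positivity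
    have hC : 0 < 1 + α ^ 2 * x := by positivity
    have hB : 0 < 1 + x := by positivity
    have e4 : 1 + (x⁻¹ + α ^ 2)⁻¹ = (1 + x + α ^ 2 * x) / (1 + α ^ 2 * x) := by
      field_simp
      ring
    rw [e4, Real.log_div hA.ne' hB.ne', Real.log_div (by positivity) hB.ne',
      Real.log_div hA.ne' hC.ne']
    simp only [mul_zero, add_zero, Real.log_one, mul_comm x (α ^ 2)]
    field_simp
    ring
  | ZF =>
    have hder : ∀ v ∈ Set.uIcc 0 (α ^ 2), HasDerivAt
        (fun v => -(1 / x) * ((1 + x * (1 - v)) * Real.log (1 + x * (1 - v)) - (1 + x * (1 - v))))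
        (Real.log (1 + pairSinr Beamforming.ZF x v)) v := by
      intro v hv
      rw [Set.uIcc_of_le hα2p] at hv
      have h0 : 0 ≤ x * (1 - v) := mul_nonneg hx.le (by linarith [hv.2])
      have h1 : 1 + x * (1 - v) ≠ 0 := by positivity
      have e1 : HasDerivAt (fun v => 1 + x * (1 - v)) (-x) v := by
        simpa using (((hasDerivAt_id v).const_sub 1).const_mul x).const_add 1
      have h := ((hasDerivAt_mul_log_sub h1).comp v e1).const_mul (-(1 / x))
      refine h.congr_deriv ?_
      simp only [pairSinr]
      field_simp
    rw [intervalIntegral.integral_eq_sub_of_hasDerivAt hder hint]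
    simp only [Upsilon, sub_zero, mul_one, mul_comm x (1 - α ^ 2)]
    field_simp
    ring

lemma Upsilon_nonneg (l : Beamforming) {x α : ℝ} (hx : 0 < x) (hα0 : 0 < α) (hα1 : α ≤ 1) :
    0 ≤ Upsilon l α x := by
  rw [← integral_log_one_add_pairSinr l hx hα0 hα1]
  refine intervalIntegral.integral_nonneg (sq_nonneg α) fun v hv => Real.log_nonneg ?_
  linarith [pairSinr_nonneg l hx hv.1 (hv.2.trans (by nlinarith))]

/-- By `log(1 + s) ≤ s` and SINR at most `x`, the integrand is bounded by `x` on an interval of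
length `α² ≤ 1`. This supplies the domination needed for all integrability claims. -/
lemma Upsilon_le (l : Beamforming) {x α : ℝ} (hx : 0 < x) (hα0 : 0 < α) (hα1 : α ≤ 1) :
    Upsilon l α x ≤ x := by
  have hα2 : α ^ 2 ≤ 1 := by nlinarith
  rw [← integral_log_one_add_pairSinr l hx hα0 hα1]
  have h := intervalIntegral.norm_integral_le_of_norm_le_const (a := 0) (b := α ^ 2) (C := x)
    (f := fun v => Real.log (1 + pairSinr l x v)) fun v hv => by
      rw [Set.uIoc_of_le (sq_nonneg α)] at hv
      have h0 := pairSinr_nonneg l hx hv.1.le (hv.2.trans hα2)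
      rw [Real.norm_of_nonneg (Real.log_nonneg (by linarith))]
      have := Real.log_le_sub_one_of_pos (x := 1 + pairSinr l x v) (by linarith)
      linarith [pairSinr_le l hx hv.1.le]
  rw [sub_zero, abs_of_nonneg (sq_nonneg α)] at h
  refine (le_abs_self _).trans (h.trans ?_)
  nlinarith

lemma lintegral_unifLaw_pairSinr (l : Beamforming) {x α : ℝ} (hx : 0 < x) (hα0 : 0 < α)
    (hα1 : α ≤ 1) :
    ∫⁻ v, (if v ≤ α ^ 2 then ENNReal.ofReal (Real.log (1 + pairSinr l x v)) else 0) ∂unifLaw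
      = ENNReal.ofReal (Upsilon l α x) := by
  have hα2 : α ^ 2 ≤ 1 := by nlinarith
  have hα2p : 0 ≤ α ^ 2 := sq_nonneg α
  have hint : IntegrableOn (fun v => Real.log (1 + pairSinr l x v)) (Set.Ioc 0 (α ^ 2)) :=
    (((continuousOn_log_one_add_pairSinr l hx).mono
      (Set.Icc_subset_Icc_right hα2)).integrableOn_Icc).mono_set Set.Ioc_subset_Icc_self
  rw [← integral_log_one_add_pairSinr l hx hα0 hα1, intervalIntegral.integral_of_le hα2p,
    ofReal_integral_eq_lintegral_ofReal hint, unifLaw]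
  · have : ∀ v : ℝ, (if v ≤ α ^ 2 then ENNReal.ofReal (Real.log (1 + pairSinr l x v)) else 0)
        = (Set.Iic (α ^ 2)).indicator
          (fun v => ENNReal.ofReal (Real.log (1 + pairSinr l x v))) v := fun v => by
      simp [Set.indicator]
    simp_rw [this]
    rw [lintegral_indicator measurableSet_Iic, Measure.restrict_restrict measurableSet_Iic,
      Set.inter_comm, Set.Ioc_inter_Iic, min_eq_right hα2]
  · filter_upwards [ae_restrict_mem measurableSet_Ioc] with v hv
    refine Real.log_nonneg ?_
    linarith [pairSinr_nonneg l hx hv.1.le (hv.2.trans hα2)]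

lemma measurable_pairSinr (l : Beamforming) : Measurable fun p : ℝ × ℝ => pairSinr l p.1 p.2 := by
  cases l with
  | MRT => simp only [pairSinr]; fun_prop
  | ZF => simp only [pairSinr]; fun_prop

lemma measurable_Upsilon (l : Beamforming) (α : ℝ) : Measurable (Upsilon l α) := by
  cases l with
  | MRT => unfold Upsilon; fun_prop
  | ZF => unfold Upsilon; fun_prop

lemma unifLaw_gt (α : ℝ) :
    ∫⁻ v, (if α ^ 2 < v then 1 else 0) ∂unifLaw = ENNReal.ofReal (1 - α ^ 2) := by
  have : ∀ v : ℝ, (if α ^ 2 < v then (1 : ℝ≥0∞) else 0) = (Set.Ioi (α ^ 2)).indicator 1 v :=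
    fun v => by simp [Set.indicator]
  simp_rw [this]
  rw [lintegral_indicator_one measurableSet_Ioi, unifLaw, Measure.restrict_apply measurableSet_Ioi,
    Set.inter_comm, Set.Ioc_inter_Ioi, max_eq_right (sq_nonneg α), Real.volume_Ioc]

/-! ### The incomplete Gamma functions as tails of the law of the squared norm -/

lemma integrableOn_mul_exp_neg : IntegrableOn (fun t : ℝ => t * Real.exp (-t)) (Set.Ioi 0) := by
  have h := Real.GammaIntegral_convergent (s := 2) two_pos
  refine h.congr_fun (fun t _ => ?_) measurableSet_Ioi
  norm_num
  ring

lemma rpow_two_sub_one (t : ℝ) : t ^ ((2 : ℝ) - 1) = t := by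
  norm_num

lemma normSqLaw_apply {s : Set ℝ} (hs : MeasurableSet s) :
    normSqLaw s = ENNReal.ofReal (∫ t in s ∩ Set.Ioi 0, t * Real.exp (-t)) := by
  rw [normSqLaw, withDensity_apply _ hs, Measure.restrict_restrict hs,
    ofReal_integral_eq_lintegral_ofReal (integrableOn_mul_exp_neg.mono_set Set.inter_subset_right)]
  filter_upwards [ae_restrict_mem (hs.inter measurableSet_Ioi)] with t ht
  exact mul_nonneg (le_of_lt ht.2) (Real.exp_nonneg _)

lemma normSqLaw_Iio {x : ℝ} (hx : 0 ≤ x) :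
    normSqLaw (Set.Iio x) = ENNReal.ofReal (lowerGamma 2 x) := by
  rw [normSqLaw_apply measurableSet_Iio, lowerGamma, intervalIntegral.integral_of_le hx,
    integral_Ioc_eq_integral_Ioo, Set.inter_comm, Set.Ioi_inter_Iio]
  simp_rw [rpow_two_sub_one]

lemma normSqLaw_Ioi {x : ℝ} (hx : 0 ≤ x) :
    normSqLaw (Set.Ioi x) = ENNReal.ofReal (upperGamma 2 x) := by
  rw [normSqLaw_apply measurableSet_Ioi, upperGamma, Set.Ioi_inter_Ioi, max_eq_left hx]
  simp_rw [rpow_two_sub_one]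

lemma lowerGamma_two_nonneg {x : ℝ} (hx : 0 ≤ x) : 0 ≤ lowerGamma 2 x :=
  intervalIntegral.integral_nonneg hx fun _ ht =>
    mul_nonneg (Real.rpow_nonneg ht.1 _) (Real.exp_nonneg _)

lemma upperGamma_two_nonneg {x : ℝ} (hx : 0 ≤ x) : 0 ≤ upperGamma 2 x :=
  setIntegral_nonneg measurableSet_Ioi fun _ ht =>
    mul_nonneg (Real.rpow_nonneg (hx.trans (le_of_lt ht)) _) (Real.exp_nonneg _)

lemma lowerGamma_two_eq {x : ℝ} (hx : 0 ≤ x) : lowerGamma 2 x = normSqLaw.real (Set.Iio x) := by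
  rw [Measure.real, normSqLaw_Iio hx, ENNReal.toReal_ofReal (lowerGamma_two_nonneg hx)]

lemma upperGamma_two_eq {x : ℝ} (hx : 0 ≤ x) : upperGamma 2 x = normSqLaw.real (Set.Ioi x) := by
  rw [Measure.real, normSqLaw_Ioi hx, ENNReal.toReal_ofReal (upperGamma_two_nonneg hx)]

lemma measurable_real_Iio (ν : Measure ℝ) [IsFiniteMeasure ν] :
    Measurable fun x => ν.real (Set.Iio x) :=
  Monotone.measurable fun _ _ h => measureReal_mono (Set.Iio_subset_Iio h)

lemma measurable_real_Ioi (ν : Measure ℝ) [IsFiniteMeasure ν] :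
    Measurable fun x => ν.real (Set.Ioi x) :=
  Antitone.measurable fun _ _ h => measureReal_mono (Set.Ioi_subset_Ioi h)

/-- Once written as probabilities, the incomplete Gamma functions are bounded by `1` and measurable
by monotonicity. -/
lemma rateIntegrand_eq (l : Beamforming) {σ α : ℝ} (hσ : 0 < σ) {g : Fin K → ℝ}
    (hg : ∀ k, 0 < g k) (i : ℕ) (k : Fin K) {x : ℝ} (hx : 0 < x) :
    rateIntegrand l σ α g i k x = Upsilon l α x * x * Real.exp (-(σ ^ 2 / g k * x)) *
      ∑ m : Fin ((K - 1).choose (K - i)),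
        (∏ j : Fin (K - i), normSqLaw.real (Set.Iio (σ ^ 2 / g (combMatrix k i m j) * x))) *
          ∏ j : Fin (i - 1), normSqLaw.real (Set.Ioi (σ ^ 2 / g (compMatrix k i m j) * x)) := by
  have h : ∀ j, 0 ≤ σ ^ 2 / g j * x := fun j => by
    have := hg j
    positivity
  simp only [rateIntegrand, lowerGamma_two_eq (h _), upperGamma_two_eq (h _)]

lemma rateIntegrand_nonneg (l : Beamforming) {σ α : ℝ} (hσ : 0 < σ) (hα0 : 0 < α) (hα1 : α ≤ 1)
    {g : Fin K → ℝ} (hg : ∀ k, 0 < g k) (i : ℕ) (k : Fin K) {x : ℝ} (hx : 0 < x) :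
    0 ≤ rateIntegrand l σ α g i k x := by
  rw [rateIntegrand_eq l hσ hg i k hx]
  refine mul_nonneg (mul_nonneg (mul_nonneg (Upsilon_nonneg l hx hα0 hα1) hx.le)
    (Real.exp_nonneg _)) (Finset.sum_nonneg fun m _ => mul_nonneg ?_ ?_) <;>
  exact Finset.prod_nonneg fun j _ => measureReal_nonneg

lemma integrableOn_rateIntegrand (l : Beamforming) {σ α : ℝ} (hσ : 0 < σ) (hα0 : 0 < α)
    (hα1 : α ≤ 1) {g : Fin K → ℝ} (hg : ∀ k, 0 < g k) (i : ℕ) (k : Fin K) :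
    IntegrableOn (rateIntegrand l σ α g i k) (Set.Ioi 0) := by
  have hc : 0 < σ ^ 2 / g k := div_pos (by positivity) (hg k)
  refine IntegrableOn.congr_fun ?_ (fun x hx => (rateIntegrand_eq l hσ hg i k hx).symm)
    measurableSet_Ioi
  -- Each row contributes at most `1` and `Υ(x) x ≤ x²`, so the number of rows times `x² e^{-cx}`
  -- dominates.
  have hbound : IntegrableOn (fun x : ℝ => ((K - 1).choose (K - i) : ℝ) *
      (x ^ (2 : ℝ) * Real.exp (-(σ ^ 2 / g k) * x ^ (1 : ℝ)))) (Set.Ioi 0) :=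
    (integrableOn_rpow_mul_exp_neg_mul_rpow (by norm_num) one_pos hc).const_mul _
  refine Integrable.mono' hbound (Measurable.aestronglyMeasurable ?_) ?_
  · have hU := measurable_Upsilon l α
    have h1 : ∀ c : ℝ, Measurable fun x => normSqLaw.real (Set.Iio (c * x)) := fun c =>
      (measurable_real_Iio normSqLaw).comp (f := fun x => c * x) (by fun_prop)
    have h2 : ∀ c : ℝ, Measurable fun x => normSqLaw.real (Set.Ioi (c * x)) := fun c =>
      (measurable_real_Ioi normSqLaw).comp (f := fun x => c * x) (by fun_prop)
    refine Measurable.mul (by fun_prop) (Finset.measurable_sum _ fun m _ => Measurable.mul ?_ ?_)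
    · exact Finset.measurable_prod _ fun j _ => h1 _
    · exact Finset.measurable_prod _ fun j _ => h2 _
  · filter_upwards [ae_restrict_mem measurableSet_Ioi] with x hx
    have hx : 0 < x := hx
    rw [← rateIntegrand_eq l hσ hg i k hx,
      Real.norm_of_nonneg (rateIntegrand_nonneg l hσ hα0 hα1 hg i k hx),
      rateIntegrand_eq l hσ hg i k hx, mul_comm]
    refine mul_le_mul ?_ ?_ ?_ (by positivity)
    · refine (Finset.sum_le_card_nsmul _ _ 1 fun m _ => ?_).trans (by simp)
      refine mul_le_one₀ ?_ (Finset.prod_nonneg fun j _ => measureReal_nonneg) ?_ <;>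
      exact Finset.prod_le_one (fun j _ => measureReal_nonneg) fun j _ => measureReal_le_one
    · have hsq : x ^ (2 : ℝ) = x * x := by rw [Real.rpow_two, pow_two]
      rw [Real.rpow_one, hsq, neg_mul]
      exact mul_le_mul_of_nonneg_right
        (mul_le_mul_of_nonneg_right (Upsilon_le l hx hα0 hα1) hx.le) (Real.exp_nonneg _)
    · exact mul_nonneg (mul_nonneg (Upsilon_nonneg l hx hα0 hα1) hx.le) (Real.exp_nonneg _)

/-! ### Sums over the rows of the matrices of combinations -/

lemma prod_getElem_eq_prod_map {M : Type*} [CommMonoid M] {β : Type*} (f : β → M) :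
    ∀ {n : ℕ} (L : List β) (hL : L.length = n),
      ∏ j : Fin n, f (L[(j : ℕ)]'(by rw [hL]; exact j.2)) = (L.map f).prod := by
  rintro n L rfl
  exact Fin.prod_univ_fun_getElem L f

lemma sum_getElem_eq_sum_map {M : Type*} [AddCommMonoid M] {β : Type*} (f : β → M) :
    ∀ {n : ℕ} (L : List β) (hL : L.length = n),
      ∑ j : Fin n, f (L[(j : ℕ)]'(by rw [hL]; exact j.2)) = (L.map f).sum := by
  rintro n L rfl
  exact Fin.sum_univ_fun_getElem L f

lemma prod_combMatrix {M : Type*} [CommMonoid M] (f : Fin K → M) (k : Fin K) (i : ℕ)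
    (m : Fin ((K - 1).choose (K - i))) :
    ∏ j, f (combMatrix k i m j) = ((combRow k i m).map f).prod :=
  prod_getElem_eq_prod_map f (combRow k i m) (length_combRow k i m)

lemma prod_compMatrix {M : Type*} [CommMonoid M] (f : Fin K → M) (k : Fin K) {i : ℕ}
    (h1 : 1 ≤ i) (hi : i ≤ K) (m : Fin ((K - 1).choose (K - i))) :
    ∏ j, f (compMatrix k i m j) = ((compRow k i m).map f).prod := by
  rw [← prod_getElem_eq_prod_map f (compRow k i m) (length_compRow k i h1 hi m)]
  refine Finset.prod_congr rfl fun j _ => ?_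
  congr 1
  exact List.getD_eq_getElem _ _ _

/-- Products and sums do not see the order within rows or of the rows. Passing from lists to
multisets and then to finsets turns the matrix rows into subsets of size `K - i` and their
complements. -/
lemma sum_combinations {R : Type*} [CommSemiring R] (f h : Fin K → R) (k : Fin K) {i : ℕ}
    (h1 : 1 ≤ i) (hi : i ≤ K) :
    ∑ m, (∏ j, f (combMatrix k i m j)) * ∏ j, h (compMatrix k i m j)
      = ∑ A ∈ (Finset.univ.erase k).powersetCard (K - i),
          (∏ j ∈ A, f j) * ∏ j ∈ (Finset.univ.erase k).filter (· ∉ A), h j := by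
  set F : Multiset (Fin K) → R := fun M =>
    (M.map f).prod * (((Finset.univ.erase k).val.filter (· ∉ M)).map h).prod with hF
  have hval : (Finset.univ.erase k).val = (((List.finRange K).erase k : List (Fin K)) :
      Multiset (Fin K)) := by
    rw [Finset.erase_val, ← Multiset.coe_erase]
    rfl
  have hL : ∀ m, (∏ j, f (combMatrix k i m j)) * ∏ j, h (compMatrix k i m j)
      = F (combRow k i m) := by
    intro m
    rw [prod_combMatrix, prod_compMatrix h k h1 hi, hF]
    dsimp only
    rw [hval, Multiset.filter_coe, Multiset.map_coe, Multiset.map_coe, Multiset.prod_coe,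
      Multiset.prod_coe]
    rfl
  simp_rw [hL]
  have hsum := sum_getElem_eq_sum_map (fun L : List (Fin K) => F L) (combinations k (K - i))
    (length_combinations k (K - i))
  refine hsum.trans ?_
  have hcomp : ∀ s : Multiset (Finset (Fin K)), s.map (fun A => F A.val)
      = (s.map Finset.val).map F := fun s => by rw [Multiset.map_map]; rfl
  have hR : ∑ A ∈ (Finset.univ.erase k).powersetCard (K - i),
      (∏ j ∈ A, f j) * ∏ j ∈ (Finset.univ.erase k).filter (· ∉ A), h j
      = ∑ A ∈ (Finset.univ.erase k).powersetCard (K - i), F A.val := rfl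
  rw [hR, Finset.sum_eq_multiset_sum, hcomp, Finset.map_val_val_powersetCard, hval,
    Multiset.powersetCard_coe, Multiset.map_coe, Multiset.sum_coe, combinations, List.map_reverse,
    List.sum_reverse, List.map_map]
  rfl

/-- Exactly one choice of a set of `K - i` weaker users is compatible with a configuration in which
`i - 1` users are stronger than `k`, and none is compatible with any other configuration. -/
lemma sum_powersetCard_rank {a : Fin K → ℝ} (ha : Function.Injective a) (k : Fin K) {i : ℕ}
    (h1 : 1 ≤ i) (hi : i ≤ K) :
    ∑ A ∈ (Finset.univ.erase k).powersetCard (K - i),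
        (∏ j ∈ A, if a j < a k then (1 : ℝ≥0∞) else 0)
          * ∏ j ∈ (Finset.univ.erase k).filter (· ∉ A), (if a k < a j then (1 : ℝ≥0∞) else 0)
      = if (Finset.univ.filter fun j => a k < a j).card = i - 1 then 1 else 0 := by
  -- The set of users weaker than `k` is the only `A` with nonzero product. By injectivity its size
  -- is `K - 1` minus the number of stronger users, so it is among the summands iff `k` has rank
  -- `i`.
  set B := Finset.univ.filter fun j => a j < a k with hB
  have hBk : B ⊆ Finset.univ.erase k := by
    intro j hj
    refine Finset.mem_erase.2 ⟨?_, Finset.mem_univ j⟩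
    rintro rfl
    simp [hB] at hj
  have hterm : ∀ A ∈ (Finset.univ.erase k).powersetCard (K - i),
      (∏ j ∈ A, if a j < a k then (1 : ℝ≥0∞) else 0)
          * ∏ j ∈ (Finset.univ.erase k).filter (· ∉ A), (if a k < a j then (1 : ℝ≥0∞) else 0)
        = if A = B then 1 else 0 := by
    intro A hA
    have hAk := (Finset.mem_powersetCard.1 hA).1
    split_ifs with hAB
    · rw [Finset.prod_eq_one, Finset.prod_eq_one, one_mul]
      · intro j hj
        rw [if_pos]
        simp only [hAB, hB, Finset.mem_filter, Finset.mem_erase, Finset.mem_univ, and_true,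
          true_and, not_lt] at hj
        exact lt_of_le_of_ne hj.2 fun h => hj.1 (ha h).symm
      · intro j hj
        rw [if_pos]
        simpa [hAB, hB] using hj
    · by_contra hne
      refine hAB (Finset.Subset.antisymm (fun j hj => ?_) fun j hj => ?_)
      · by_contra hjB
        refine hne ?_
        rw [Finset.prod_eq_zero hj, zero_mul]
        simpa [hB] using hjB
      · by_contra hjA
        refine hne ?_
        rw [Finset.prod_eq_zero (i := j)
          (s := (Finset.univ.erase k).filter (· ∉ A)), mul_zero]
        · simp only [Finset.mem_filter]
          exact ⟨hBk hj, hjA⟩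
        · rw [if_neg]
          simp only [hB, Finset.mem_filter, Finset.mem_univ, true_and] at hj
          exact not_lt.2 hj.le
  rw [Finset.sum_congr rfl hterm, Finset.sum_ite_eq']
  have hcompl : Finset.univ.filter (fun j => a k < a j) = Finset.univ.erase k \ B := by
    ext j
    simp only [hB, Finset.mem_filter, Finset.mem_univ, true_and, Finset.mem_sdiff,
      Finset.mem_erase, and_true, not_lt]
    constructor
    · intro h
      exact ⟨fun hjk => by simp [hjk] at h, h.le⟩
    · rintro ⟨h2, h3⟩
      exact lt_of_le_of_ne h3 fun h => h2 (ha h).symm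
  have hcard := Finset.card_sdiff_of_subset hBk
  rw [← hcompl, Finset.card_erase_of_mem (Finset.mem_univ k), Finset.card_univ,
    Fintype.card_fin] at hcard
  have hBle := Finset.card_le_card hBk
  rw [Finset.card_erase_of_mem (Finset.mem_univ k), Finset.card_univ, Fintype.card_fin] at hBle
  have hiff : B ∈ (Finset.univ.erase k).powersetCard (K - i) ↔
      (Finset.univ.filter fun j => a k < a j).card = i - 1 := by
    rw [Finset.mem_powersetCard, hcard]
    constructor
    · rintro ⟨_, h⟩
      omega
    · intro h
      exact ⟨hBk, by omega⟩
  simp only [hiff]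

/-! ### Integrating out the correlations -/

lemma measurable_selFactor (α : ℝ) {ψ : ℝ → ℝ → ℝ≥0∞}
    (hψ : Measurable fun q : ℝ × ℝ => ψ q.1 q.2) (p k j : Fin K) :
    Measurable fun q : (Fin K → ℝ) × (Fin K → ℝ) =>
      selFactor α q.1 (ψ (q.1 k)) p k j (q.2 j) := by
  unfold selFactor
  split_ifs
  · exact measurable_const
  · refine Measurable.ite (measurableSet_le (by fun_prop) (by fun_prop)) ?_ measurable_const
    exact hψ.comp (f := fun q : (Fin K → ℝ) × (Fin K → ℝ) => (q.1 k, q.2 j)) (by fun_prop)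
  · exact Measurable.ite (measurableSet_lt (by fun_prop) (by fun_prop))
      (Measurable.ite (measurableSet_lt (by fun_prop) (by fun_prop)) measurable_const
        measurable_const) measurable_const

lemma measurableSet_isMax (p : Fin K) :
    MeasurableSet {q : (Fin K → ℝ) × (Fin K → ℝ) | ∀ j, j ≠ p → q.1 j < q.1 p} := by
  simp only [Set.ofPred_forall]
  exact MeasurableSet.iInter fun j => MeasurableSet.iInter fun _ =>
    measurableSet_lt (by fun_prop) (by fun_prop)

lemma measurable_selWeight (α : ℝ) {ψ : ℝ → ℝ → ℝ≥0∞}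
    (hψ : Measurable fun q : ℝ × ℝ => ψ q.1 q.2) (p : Fin K) :
    Measurable fun q : (Fin K → ℝ) × (Fin K → ℝ) => selWeight α ψ p q.1 q.2 :=
  Measurable.ite (measurableSet_isMax p) (Finset.measurable_sum _ fun k _ =>
    Finset.measurable_prod _ fun j _ => measurable_selFactor α hψ p k j) measurable_const

lemma selWeight_congr (α : ℝ) (ψ : ℝ → ℝ → ℝ≥0∞) (p : Fin K) (a : Fin K → ℝ) {V V' : Fin K → ℝ}
    (hV : ∀ j, j ≠ p → V j = V' j) : selWeight α ψ p a V = selWeight α ψ p a V' := by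
  unfold selWeight
  congr 1
  refine Finset.sum_congr rfl fun k _ => Finset.prod_congr rfl fun j _ => ?_
  by_cases hj : j = p
  · simp [selFactor, hj]
  · rw [hV j hj]

lemma measurable_soloWeight (α : ℝ) (p : Fin K) :
    Measurable fun q : (Fin K → ℝ) × (Fin K → ℝ) => soloWeight α p q.1 q.2 :=
  Measurable.ite (measurableSet_isMax p) (Finset.measurable_prod _ fun j _ =>
    Measurable.ite (measurableSet_lt (by fun_prop) (by fun_prop)) measurable_const
      measurable_const) measurable_const

lemma soloWeight_congr (α : ℝ) (p : Fin K) (a : Fin K → ℝ) {V V' : Fin K → ℝ}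
    (hV : ∀ j, j ≠ p → V j = V' j) : soloWeight α p a V = soloWeight α p a V' := by
  unfold soloWeight
  congr 1
  refine Finset.prod_congr rfl fun j hj => ?_
  rw [hV j (Finset.ne_of_mem_erase hj)]

/-- The correlations are independent, so the product factorises: `k` gives the integral of `ψ`, and
each user between `k` and `p` gives `1 - α²`. The exponent is the number of users stronger than `k`,
less one because `p` is among them and faces no test. -/
lemma lintegral_selWeight (α : ℝ) {ψ : ℝ → ℝ → ℝ≥0∞}
    (hψ : ∀ x, Measurable (ψ x)) (p : Fin K) (a : Fin K → ℝ) :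
    ∫⁻ V, selWeight α ψ p a V ∂(Measure.pi fun _ => unifLaw)
      = if ∀ j, j ≠ p → a j < a p then
          ∑ k ∈ Finset.univ.erase p, (∫⁻ v, (if v ≤ α ^ 2 then ψ (a k) v else 0) ∂unifLaw) *
            ENNReal.ofReal (1 - α ^ 2) ^ ((Finset.univ.filter fun j => a k < a j).card - 1)
        else 0 := by
  unfold selWeight
  split_ifs with hp
  swap
  · simp
  have hm : ∀ k j, Measurable (selFactor α a (ψ (a k)) p k j) := by
    intro k j
    have hψk := hψ (a k)
    unfold selFactor
    split_ifs
    · exact measurable_const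
    · exact Measurable.ite measurableSet_Iic hψk measurable_const
    · exact Measurable.ite measurableSet_Ioi measurable_const measurable_const
    · exact measurable_const
  have hmp : ∀ k, Measurable fun V : Fin K → ℝ => ∏ j, selFactor α a (ψ (a k)) p k j (V j) :=
    fun k => Finset.measurable_prod _ fun j _ => (hm k j).comp (measurable_pi_apply j)
  rw [lintegral_finsetSum _ fun k _ => hmp k]
  refine Finset.sum_congr rfl fun k hk => ?_
  have hkp := Finset.ne_of_mem_erase hk
  rw [lintegral_pi_prod unifLaw (hm k), ← Finset.mul_prod_erase _ _ (Finset.mem_univ k)]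
  congr 1
  · simp [selFactor, hkp]
  · have e : ∀ j ∈ Finset.univ.erase k, ∫⁻ v, selFactor α a (ψ (a k)) p k j v ∂unifLaw
        = if j ≠ p ∧ a k < a j then ENNReal.ofReal (1 - α ^ 2) else 1 := by
      intro j hj
      have hjk := Finset.ne_of_mem_erase hj
      by_cases hjp : j = p
      · simp [selFactor, hjp]
      by_cases hlt : a k < a j
      · simp only [selFactor, hjp, hjk, hlt, if_false, if_true, unifLaw_gt, ne_eq,
          not_false_eq_true, and_self]
      · simp [selFactor, hjp, hjk, hlt]
    rw [Finset.prod_congr rfl e, Finset.prod_ite, Finset.prod_const, Finset.prod_const_one, mul_one]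
    congr 1
    rw [← Finset.card_erase_of_mem (a := p) (by simpa using hp k hkp)]
    congr 1
    ext j
    simp only [Finset.mem_filter, Finset.mem_erase, Finset.mem_univ, and_true, true_and]
    constructor
    · rintro ⟨_, h⟩
      exact h
    · rintro ⟨h1, h2⟩
      exact ⟨fun h => by simp [h] at h2, h1, h2⟩

lemma lintegral_soloWeight (α : ℝ) (p : Fin K) (a : Fin K → ℝ) :
    ∫⁻ V, soloWeight α p a V ∂(Measure.pi fun _ => unifLaw)
      = if ∀ j, j ≠ p → a j < a p then ENNReal.ofReal (1 - α ^ 2) ^ (K - 1) else 0 := by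
  unfold soloWeight
  split_ifs with hp
  swap
  · simp
  have hm : Measurable fun v : ℝ => if α ^ 2 < v then (1 : ℝ≥0∞) else 0 :=
    Measurable.ite measurableSet_Ioi measurable_const measurable_const
  have h := lintegral_pi_prod_erase unifLaw p (F := fun _ => 1) measurable_const
    (φ := fun _ _ v => if α ^ 2 < v then 1 else 0) fun j => hm.comp measurable_snd
  simp only [one_mul] at h
  rw [h]
  simp_rw [unifLaw_gt]
  simp

/-- Reordering the sum over the first user by the rank of the second user. -/
lemma sum_isMax_eq_sum_rank {a : Fin K → ℝ} (hK : 0 < K) (ha : Function.Injective a)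
    (f : Fin K → ℝ≥0∞) (q : ℝ≥0∞) :
    ∑ p, (if ∀ j, j ≠ p → a j < a p then
        ∑ k ∈ Finset.univ.erase p, f k * q ^ ((Finset.univ.filter fun j => a k < a j).card - 1)
        else 0)
      = ∑ i ∈ Finset.Icc 2 K, q ^ (i - 2) * ∑ k,
          f k * (if (Finset.univ.filter fun j => a k < a j).card = i - 1 then 1 else 0) := by
  obtain ⟨p, hp⟩ := exists_strict_max hK ha
  rw [sum_ite_max hp fun p => ∑ k ∈ Finset.univ.erase p,
    f k * q ^ ((Finset.univ.filter fun j => a k < a j).card - 1)]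
  simp_rw [Finset.mul_sum]
  rw [Finset.sum_comm, ← Finset.add_sum_erase _ _ (Finset.mem_univ p)]
  have hzero : (Finset.univ.filter fun j => a p < a j).card = 0 := by
    rw [Finset.card_eq_zero, Finset.filter_eq_empty_iff]
    intro j _ hj
    by_cases h : j = p
    · simp [h] at hj
    · exact lt_asymm hj (hp j h)
  -- The first user has rank `1` and the ranks start at `2`, so the term `k = p`, absent on the
  -- left, is zero on the right.
  rw [hzero, Finset.sum_eq_zero (s := Finset.Icc 2 K), zero_add]
  swap
  · intro i hi
    rw [if_neg (by have := (Finset.mem_Icc.1 hi).1; omega)]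
    simp
  refine Finset.sum_congr rfl fun k hk => ?_
  have hkp := Finset.ne_of_mem_erase hk
  set c := (Finset.univ.filter fun j => a k < a j).card with hc
  have hc1 : 1 ≤ c := Finset.card_pos.2 ⟨p, by simpa using hp k hkp⟩
  have hcK : c ≤ K - 1 := by
    have h : (Finset.univ.filter fun j => a k < a j) ⊆ Finset.univ.erase k := by
      intro j hj
      simp only [Finset.mem_filter, Finset.mem_univ, true_and] at hj
      exact Finset.mem_erase.2 ⟨fun h => by simp [h] at hj, Finset.mem_univ j⟩
    have := Finset.card_le_card h
    rwa [Finset.card_erase_of_mem (Finset.mem_univ k), Finset.card_univ, Fintype.card_fin] at this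
  rw [Finset.sum_eq_single (c + 1)]
  · rw [if_pos (by omega), mul_one, mul_comm]
    congr 2
  · intro i hi hne
    rw [if_neg (by have := (Finset.mem_Icc.1 hi).1; omega)]
    simp
  · intro h
    exact absurd (Finset.mem_Icc.2 ⟨by omega, by omega⟩) h

/-! ### The mean rate of the second user -/

lemma lintegral_Ioi_comp_mul {c : ℝ} (hc : 0 < c) {G : ℝ → ℝ≥0∞} (hG : Measurable G) :
    ∫⁻ t in Set.Ioi (0 : ℝ), G t = ∫⁻ x in Set.Ioi (0 : ℝ), ENNReal.ofReal c * G (c * x) := by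
  rw [lintegral_const_mul _ (by fun_prop), ← lintegral_indicator measurableSet_Ioi,
    ← lintegral_indicator measurableSet_Ioi]
  have h := Real.smul_map_volume_mul_left hc.ne'
  rw [abs_of_pos hc] at h
  conv_lhs => rw [← h]
  rw [lintegral_smul_measure, smul_eq_mul,
    lintegral_map (hG.indicator measurableSet_Ioi) (by fun_prop)]
  congr 1
  refine lintegral_congr fun x => ?_
  simp [Set.indicator, hc]

lemma normSqLaw_pos : ∀ᵐ t ∂normSqLaw, 0 < t := by
  refine (withDensity_absolutelyContinuous _ _).ae_le ?_
  exact ae_restrict_mem measurableSet_Ioi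

/-- Under `t = cx` the measure `t e^{-t} dt` becomes `c² x e^{-cx} dx`. With `c = σ²/g_k` this is
the origin of the prefactor `σ⁴/g_k²`. -/
lemma lintegral_normSqLaw_comp_mul {c : ℝ} (hc : 0 < c) {H : ℝ → ℝ≥0∞} (hH : Measurable H) :
    ∫⁻ t, H (t / c) ∂normSqLaw = ENNReal.ofReal (c ^ 2) *
      ∫⁻ x in Set.Ioi (0 : ℝ), ENNReal.ofReal (x * Real.exp (-(c * x))) * H x := by
  rw [normSqLaw, lintegral_withDensity_eq_lintegral_mul _ (by fun_prop) (by fun_prop),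
    lintegral_Ioi_comp_mul hc (by fun_prop), ← lintegral_const_mul _ (by fun_prop)]
  refine setLIntegral_congr_fun measurableSet_Ioi fun x hx => ?_
  have hx : 0 < x := hx
  simp only [Pi.mul_apply]
  rw [mul_div_cancel_left₀ x hc.ne', ← mul_assoc, ← mul_assoc,
    ← ENNReal.ofReal_mul hc.le, ← ENNReal.ofReal_mul (by positivity)]
  congr 2
  ring

lemma measurable_normSqLaw_Iio : Measurable fun x => normSqLaw (Set.Iio x) :=
  Monotone.measurable fun _ _ h => measure_mono (Set.Iio_subset_Iio h)

lemma measurable_normSqLaw_Ioi : Measurable fun x => normSqLaw (Set.Ioi x) :=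
  Antitone.measurable fun _ _ h => measure_mono (Set.Ioi_subset_Ioi h)

/-- The contribution of the configurations in which the user `k` has rank `i`. -/
lemma lintegral_rank {c : Fin K → ℝ} (hc : ∀ k, 0 < c k) {Ψ : ℝ → ℝ≥0∞} (hΨ : Measurable Ψ)
    (k : Fin K) {i : ℕ} (h1 : 1 ≤ i) (hi : i ≤ K) :
    ∫⁻ T, Ψ (T k / c k) *
        (if (Finset.univ.filter fun j => T k / c k < T j / c j).card = i - 1 then 1 else 0)
        ∂(Measure.pi fun _ : Fin K => normSqLaw)
      = ENNReal.ofReal (c k ^ 2) * ∫⁻ x in Set.Ioi (0 : ℝ),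
          ENNReal.ofReal (x * Real.exp (-(c k * x))) * (Ψ x *
            ∑ m, (∏ j, normSqLaw (Set.Iio (c (combMatrix k i m j) * x))) *
              ∏ j, normSqLaw (Set.Ioi (c (compMatrix k i m j) * x))) := by
  set S := (Finset.univ.erase k).powersetCard (K - i) with hS
  have hinj := ae_gain_injective (K := K) (g := fun j => (c j)⁻¹) fun j => inv_pos.2 (hc j)
  -- `A` is the prospective set of users weaker than `k`; `φ` tests one user `j` against `k`, so
  -- that given the norm of `k` the product factorises.
  set φ : Finset (Fin K) → Fin K → ℝ → ℝ → ℝ≥0∞ := fun A j t s =>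
    if j ∈ A then (if s / c j < t / c k then 1 else 0)
      else (if t / c k < s / c j then 1 else 0) with hφ
  have hφm : ∀ A j, Measurable fun p : ℝ × ℝ => φ A j p.1 p.2 := by
    intro A j
    simp only [hφ]
    split_ifs
    · exact Measurable.ite (measurableSet_lt (by fun_prop) (by fun_prop)) measurable_const
        measurable_const
    · exact Measurable.ite (measurableSet_lt (by fun_prop) (by fun_prop)) measurable_const
        measurable_const
  have hsplit : ∀ A ∈ S, ∀ f h : Fin K → ℝ≥0∞,
      ∏ j ∈ Finset.univ.erase k, (if j ∈ A then f j else h j)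
        = (∏ j ∈ A, f j) * ∏ j ∈ (Finset.univ.erase k).filter (· ∉ A), h j := by
    intro A hA f h
    rw [Finset.prod_ite, Finset.filter_mem_eq_inter,
      Finset.inter_eq_right.2 (Finset.mem_powersetCard.1 hA).1]
  have hpt : ∀ᵐ T ∂(Measure.pi fun _ : Fin K => normSqLaw), Ψ (T k / c k) *
      (if (Finset.univ.filter fun j => T k / c k < T j / c j).card = i - 1 then 1 else 0)
      = ∑ A ∈ S, Ψ (T k / c k) * ∏ j ∈ Finset.univ.erase k, φ A j (T k) (T j) := by
    filter_upwards [hinj] with T hT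
    have hT' : Function.Injective fun j => T j / c j := by
      simpa only [div_eq_inv_mul] using hT
    rw [← sum_powersetCard_rank hT' k h1 hi, Finset.mul_sum]
    refine Finset.sum_congr rfl fun A hA => ?_
    simp only [hφ]
    rw [hsplit A hA]
  have hmeas : ∀ A, Measurable fun T : Fin K → ℝ =>
      Ψ (T k / c k) * ∏ j ∈ Finset.univ.erase k, φ A j (T k) (T j) := fun A =>
    Measurable.mul (by fun_prop) (Finset.measurable_prod _ fun j _ =>
      (hφm A j).comp (f := fun T : Fin K → ℝ => (T k, T j)) (by fun_prop))
  have hφint : ∀ A j t, ∫⁻ s, φ A j t s ∂normSqLaw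
      = if j ∈ A then normSqLaw (Set.Iio (c j * (t / c k)))
        else normSqLaw (Set.Ioi (c j * (t / c k))) := by
    intro A j t
    simp only [hφ]
    split_ifs
    · have : ∀ s, (if s / c j < t / c k then (1 : ℝ≥0∞) else 0)
          = (Set.Iio (c j * (t / c k))).indicator 1 s := fun s => by
        simp [Set.indicator, div_lt_iff₀' (hc j)]
      simp_rw [this]
      exact lintegral_indicator_one measurableSet_Iio
    · have : ∀ s, (if t / c k < s / c j then (1 : ℝ≥0∞) else 0)
          = (Set.Ioi (c j * (t / c k))).indicator 1 s := fun s => by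
        simp [Set.indicator, lt_div_iff₀' (hc j)]
      simp_rw [this]
      exact lintegral_indicator_one measurableSet_Ioi
  have hIio : ∀ a : ℝ, Measurable fun x => normSqLaw (Set.Iio (a * x)) := fun a =>
    measurable_normSqLaw_Iio.comp (f := fun x => a * x) (by fun_prop)
  have hIoi : ∀ a : ℝ, Measurable fun x => normSqLaw (Set.Ioi (a * x)) := fun a =>
    measurable_normSqLaw_Ioi.comp (f := fun x => a * x) (by fun_prop)
  set H : ℝ → ℝ≥0∞ := fun x => Ψ x * ∑ A ∈ S, (∏ j ∈ A, normSqLaw (Set.Iio (c j * x))) *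
    ∏ j ∈ (Finset.univ.erase k).filter (· ∉ A), normSqLaw (Set.Ioi (c j * x)) with hH
  have hHm : Measurable H := hΨ.mul (Finset.measurable_sum _ fun A _ =>
    (Finset.measurable_prod _ fun j _ => hIio _).mul (Finset.measurable_prod _ fun j _ => hIoi _))
  have hterm : ∀ A, Measurable fun t => Ψ (t / c k) *
      ∏ j ∈ Finset.univ.erase k, ∫⁻ s, φ A j t s ∂normSqLaw := fun A =>
    Measurable.mul (by fun_prop) (Finset.measurable_prod _ fun j _ =>
      Measurable.lintegral_prod_right' (hφm A j))
  rw [lintegral_congr_ae hpt, lintegral_finsetSum _ fun A _ => hmeas A]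
  have hstep : ∀ A ∈ S, ∫⁻ T, Ψ (T k / c k) * ∏ j ∈ Finset.univ.erase k, φ A j (T k) (T j)
      ∂(Measure.pi fun _ : Fin K => normSqLaw)
      = ∫⁻ t, Ψ (t / c k) * ∏ j ∈ Finset.univ.erase k, ∫⁻ s, φ A j t s ∂normSqLaw ∂normSqLaw :=
    fun A _ => lintegral_pi_prod_erase normSqLaw k (F := fun t => Ψ (t / c k)) (by fun_prop)
      (hφm A)
  rw [Finset.sum_congr rfl hstep, ← lintegral_finsetSum _ fun A _ => hterm A]
  have hfin : ∀ t, ∑ A ∈ S, Ψ (t / c k) * ∏ j ∈ Finset.univ.erase k, ∫⁻ s, φ A j t s ∂normSqLaw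
      = H (t / c k) := by
    intro t
    rw [hH]
    dsimp only
    rw [Finset.mul_sum]
    refine Finset.sum_congr rfl fun A hA => ?_
    simp_rw [hφint]
    rw [hsplit A hA]
  simp_rw [hfin]
  rw [lintegral_normSqLaw_comp_mul (hc k) hHm]
  congr 1
  refine lintegral_congr fun x => ?_
  rw [hH]
  dsimp only
  rw [sum_combinations (fun j => normSqLaw (Set.Iio (c j * x)))
    (fun j => normSqLaw (Set.Ioi (c j * x))) k h1 hi]

lemma ofReal_rateIntegrand (l : Beamforming) {σ α : ℝ} (hσ : 0 < σ) (hα0 : 0 < α) (hα1 : α ≤ 1)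
    {g : Fin K → ℝ} (hg : ∀ k, 0 < g k) (i : ℕ) (k : Fin K) {x : ℝ} (hx : 0 < x) :
    ENNReal.ofReal (rateIntegrand l σ α g i k x)
      = ENNReal.ofReal (x * Real.exp (-(σ ^ 2 / g k * x))) * (ENNReal.ofReal (Upsilon l α x) *
          ∑ m, (∏ j, normSqLaw (Set.Iio (σ ^ 2 / g (combMatrix k i m j) * x))) *
            ∏ j, normSqLaw (Set.Ioi (σ ^ 2 / g (compMatrix k i m j) * x))) := by
  have hU := Upsilon_nonneg l hx hα0 hα1
  rw [rateIntegrand_eq l hσ hg i k hx, ENNReal.ofReal_mul (mul_nonneg (mul_nonneg hU hx.le)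
    (Real.exp_nonneg _)), ENNReal.ofReal_sum_of_nonneg fun m _ => mul_nonneg
      (Finset.prod_nonneg fun j _ => measureReal_nonneg)
      (Finset.prod_nonneg fun j _ => measureReal_nonneg), mul_assoc (Upsilon l α x),
    ENNReal.ofReal_mul hU, mul_comm (ENNReal.ofReal (Upsilon l α x)), mul_assoc]
  congr 2
  refine Finset.sum_congr rfl fun m _ => ?_
  rw [ENNReal.ofReal_mul (Finset.prod_nonneg fun j _ => measureReal_nonneg),
    ENNReal.ofReal_prod_of_nonneg fun j _ => measureReal_nonneg,
    ENNReal.ofReal_prod_of_nonneg fun j _ => measureReal_nonneg]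
  congr 1
  · exact Finset.prod_congr rfl fun j _ => ofReal_measureReal
  · exact Finset.prod_congr rfl fun j _ => ofReal_measureReal

lemma measurable_rate_kernel (l : Beamforming) (σ : ℝ) : Measurable fun q : ℝ × ℝ =>
    ENNReal.ofReal (Real.log (1 + pairSinr l (q.1 / σ ^ 2) q.2)) := by
  have h : Measurable fun q : ℝ × ℝ => pairSinr l (q.1 / σ ^ 2) q.2 :=
    (measurable_pairSinr l).comp (f := fun q : ℝ × ℝ => (q.1 / σ ^ 2, q.2)) (by fun_prop)
  fun_prop

lemma measurable_scaled (g : Fin K → ℝ) : Measurable fun q : (Fin K → ℝ) × (Fin K → ℝ) =>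
    ((fun j => g j * q.1 j), q.2) := by
  fun_prop

lemma measurable_norms_corrs (p : Fin K) : Measurable fun x : Fin K → EuclideanSpace ℂ (Fin 2) =>
    ((fun j => ‖x j‖ ^ 2), fun j => corr (x p) (x j)) := by
  have hm1 : Measurable fun (x : Fin K → EuclideanSpace ℂ (Fin 2)) j => ‖x j‖ ^ 2 := by
    fun_prop
  have hm2 : Measurable fun (x : Fin K → EuclideanSpace ℂ (Fin 2)) j =>
      corr (x p) (x j) := measurable_pi_lambda _ fun j =>
    measurable_corr.comp (f := fun x : Fin K → EuclideanSpace ℂ (Fin 2) => (x p, x j))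
      ((measurable_pi_apply p).prodMk (measurable_pi_apply j))
  exact hm1.prodMk hm2

lemma measurable_selWeight_scaled (l : Beamforming) (σ α : ℝ) (g : Fin K → ℝ) (p : Fin K) :
    Measurable fun q : (Fin K → ℝ) × (Fin K → ℝ) =>
      selWeight α (fun a v => ENNReal.ofReal (Real.log (1 + pairSinr l (a / σ ^ 2) v))) p
        (fun j => g j * q.1 j) q.2 :=
  (measurable_selWeight α (ψ := fun a v => ENNReal.ofReal (Real.log (1 + pairSinr l (a / σ ^ 2) v)))
    (measurable_rate_kernel l σ) p).comp
    (f := fun q : (Fin K → ℝ) × (Fin K → ℝ) => ((fun j => g j * q.1 j), q.2)) (measurable_scaled g)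

lemma measurable_selWeight_channels (l : Beamforming) (σ α : ℝ) (g : Fin K → ℝ) (p : Fin K) :
    Measurable fun x : Fin K → EuclideanSpace ℂ (Fin 2) =>
      selWeight α (fun a v => ENNReal.ofReal (Real.log (1 + pairSinr l (a / σ ^ 2) v))) p
        (gain g x) fun j => corr (x p) (x j) :=
  (measurable_selWeight_scaled l σ α g p).comp (measurable_norms_corrs p)

lemma measurable_soloWeight_channels (α : ℝ) (g : Fin K → ℝ) (p : Fin K) :
    Measurable fun x : Fin K → EuclideanSpace ℂ (Fin 2) =>
      soloWeight α p (gain g x) fun j => corr (x p) (x j) :=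
  ((measurable_soloWeight α p).comp (measurable_scaled g)).comp (measurable_norms_corrs p)

lemma aemeasurable_ofReal_rate (l : Beamforming) {σ α : ℝ} (hσ : 0 < σ) {g : Fin K → ℝ}
    (hg : ∀ k, 0 < g k) (hK : 0 < K) :
    AEMeasurable (fun x => ENNReal.ofReal (secondUserRate l σ α g x))
      (Measure.pi fun _ : Fin K => channelLaw) := by
  refine ⟨fun x => ∑ p, selWeight α (fun a v => ENNReal.ofReal (Real.log (1 + pairSinr l
    (a / σ ^ 2) v))) p (gain g x) (fun j => corr (x p) (x j)), ?_, ?_⟩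
  · exact Finset.measurable_sum _ fun p _ => measurable_selWeight_channels l σ α g p
  · filter_upwards [ae_channels_generic hg] with x hx
    exact ofReal_secondUserRate l hσ hg hK hx.1 hx.2

lemma lintegral_secondUserRate (l : Beamforming) {σ α : ℝ} (hσ : 0 < σ) (hα0 : 0 < α)
    (hα1 : α ≤ 1) {g : Fin K → ℝ} (hg : ∀ k, 0 < g k) (hK : 0 < K) :
    ∫⁻ x, ENNReal.ofReal (secondUserRate l σ α g x) ∂(Measure.pi fun _ : Fin K => channelLaw)
      = ∑ i ∈ Finset.Icc 2 K, ENNReal.ofReal (1 - α ^ 2) ^ (i - 2) *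
          ∑ k, ENNReal.ofReal (σ ^ 4 / g k ^ 2) *
            ∫⁻ x in Set.Ioi (0 : ℝ), ENNReal.ofReal (rateIntegrand l σ α g i k x) := by
  set ψ : ℝ → ℝ → ℝ≥0∞ := fun a v =>
    ENNReal.ofReal (Real.log (1 + pairSinr l (a / σ ^ 2) v)) with hψ
  have hψm : ∀ a, Measurable (ψ a) := fun a =>
    (measurable_rate_kernel l σ).comp (f := fun v => (a, v)) (by fun_prop)
  set q := ENNReal.ofReal (1 - α ^ 2) with hq
  set c : Fin K → ℝ := fun k => σ ^ 2 / g k with hc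
  have hcp : ∀ k, 0 < c k := fun k => div_pos (by positivity) (hg k)
  set Ψ : ℝ → ℝ≥0∞ := fun x => ENNReal.ofReal (Upsilon l α x) with hΨ
  have hΨm : Measurable Ψ := (measurable_Upsilon l α).ennreal_ofReal
  have hdep := fun p => lintegral_norm_corr p (measurable_selWeight_scaled l σ α g p)
    fun T V V' hV => selWeight_congr α ψ p _ hV
  rw [lintegral_congr_ae ((ae_channels_generic hg).mono fun x hx =>
      ofReal_secondUserRate l hσ hg hK hx.1 hx.2),
    lintegral_finsetSum _ fun p _ => measurable_selWeight_channels l σ α g p]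
  have h1 : ∀ p, ∫⁻ x, selWeight α ψ p (gain g x) (fun j => corr (x p) (x j))
      ∂(Measure.pi fun _ : Fin K => channelLaw)
      = ∫⁻ T, ∫⁻ V, selWeight α ψ p (fun j => g j * T j) V
        ∂(Measure.pi fun _ => unifLaw) ∂(Measure.pi fun _ => normSqLaw) := hdep
  rw [Finset.sum_congr rfl fun p _ => h1 p]
  rw [← lintegral_finsetSum _ fun p _ =>
    Measurable.lintegral_prod_right' (measurable_selWeight_scaled l σ α g p)]
  have hpos : ∀ᵐ T ∂(Measure.pi fun _ : Fin K => normSqLaw), ∀ k, 0 < T k := by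
    rw [ae_all_iff]
    exact fun k => (Measure.tendsto_eval_ae_ae (μ := fun _ : Fin K => normSqLaw)
      (i := k)).eventually normSqLaw_pos
  -- Gains and normalised gains differ by the common factor `σ²`, so they rank the users alike.
  have hdiv : ∀ (T : Fin K → ℝ) j, g j * T j = σ ^ 2 * (T j / c j) := by
    intro T j
    have := (hg j).ne'
    simp only [hc]
    field_simp
  have hpt : ∀ᵐ T ∂(Measure.pi fun _ : Fin K => normSqLaw),
      ∑ p, ∫⁻ V, selWeight α ψ p (fun j => g j * T j) V ∂(Measure.pi fun _ => unifLaw)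
      = ∑ i ∈ Finset.Icc 2 K, q ^ (i - 2) * ∑ k, Ψ (T k / c k) *
        (if (Finset.univ.filter fun j => T k / c k < T j / c j).card = i - 1 then 1 else 0) := by
    filter_upwards [hpos, ae_gain_injective hg] with T hT hinj
    simp_rw [lintegral_selWeight α hψm]
    have hσ2 : 0 < σ ^ 2 := by positivity
    have hval : ∀ k, ∫⁻ v, (if v ≤ α ^ 2 then ψ (g k * T k) v else 0) ∂unifLaw
        = Ψ (T k / c k) := by
      intro k
      rw [hΨ, hψ]
      dsimp only
      rw [hdiv, mul_div_cancel_left₀ _ hσ2.ne',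
        lintegral_unifLaw_pairSinr l (div_pos (hT k) (hcp k)) hα0 hα1]
    simp_rw [hval]
    rw [sum_isMax_eq_sum_rank hK hinj (fun k => Ψ (T k / c k)) q]
    have hlt : ∀ k j, g k * T k < g j * T j ↔ T k / c k < T j / c j := by
      intro k j
      rw [hdiv, hdiv, mul_lt_mul_iff_right₀ hσ2]
    simp_rw [hlt]
  have hm : ∀ (i : ℕ) (k : Fin K), Measurable fun T : Fin K → ℝ => Ψ (T k / c k) *
      (if (Finset.univ.filter fun j => T k / c k < T j / c j).card = i - 1 then 1 else 0) := by
    intro i k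
    refine Measurable.mul (by fun_prop) (Measurable.ite ?_ measurable_const measurable_const)
    have hcard : Measurable fun T : Fin K → ℝ =>
        (Finset.univ.filter fun j => T k / c k < T j / c j).card := by
      simp_rw [Finset.card_filter]
      exact Finset.measurable_sum _ fun j _ => Measurable.ite
        (measurableSet_lt (by fun_prop) (by fun_prop)) measurable_const measurable_const
    exact hcard (measurableSet_singleton (i - 1))
  rw [lintegral_congr_ae hpt, lintegral_finsetSum _ fun i _ =>
    (Finset.measurable_sum _ fun k _ => hm i k).const_mul _]
  refine Finset.sum_congr rfl fun i hi => ?_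
  obtain ⟨hi2, hiK⟩ := Finset.mem_Icc.1 hi
  rw [lintegral_const_mul _ (Finset.measurable_sum _ fun k _ => hm i k),
    lintegral_finsetSum _ fun k _ => hm i k]
  congr 1
  refine Finset.sum_congr rfl fun k _ => ?_
  rw [lintegral_rank hcp hΨm k (by omega) hiK]
  congr 1
  · simp only [hc]
    congr 1
    ring
  · refine setLIntegral_congr_fun measurableSet_Ioi fun x hx => ?_
    exact (ofReal_rateIntegrand l hσ hα0 hα1 hg i k hx).symm

/-! ### The probability of the multi-user mode -/

/-- For every strict ordering of the gains the conditional probability that all others fail is the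
same constant, so the norms integrate out to `1`. -/
lemma lintegral_secondUser_isNone {α : ℝ} {g : Fin K → ℝ} (hg : ∀ k, 0 < g k) (hK : 0 < K) :
    ∫⁻ x, (if (secondUser α g x).isSome = true then 0 else 1)
        ∂(Measure.pi fun _ : Fin K => channelLaw)
      = ENNReal.ofReal (1 - α ^ 2) ^ (K - 1) := by
  have hm : ∀ p, Measurable fun q : (Fin K → ℝ) × (Fin K → ℝ) =>
      soloWeight α p (fun j => g j * q.1 j) q.2 := fun p =>
    (measurable_soloWeight α p).comp (measurable_scaled g)
  have hdep := fun p => lintegral_norm_corr p (hm p)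
    fun T V V' hV => soloWeight_congr α p _ hV
  rw [lintegral_congr_ae ((ae_channels_generic hg).mono fun x hx =>
      indicator_secondUser_isNone hK hx.2),
    lintegral_finsetSum _ fun p _ => measurable_soloWeight_channels α g p]
  have h1 : ∀ p, ∫⁻ x, soloWeight α p (gain g x) (fun j => corr (x p) (x j))
      ∂(Measure.pi fun _ : Fin K => channelLaw)
      = ∫⁻ T, ∫⁻ V, soloWeight α p (fun j => g j * T j) V
        ∂(Measure.pi fun _ => unifLaw) ∂(Measure.pi fun _ => normSqLaw) := hdep
  simp_rw [h1]
  rw [← lintegral_finsetSum _ fun p _ => Measurable.lintegral_prod_right' (hm p)]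
  simp_rw [lintegral_soloWeight]
  rw [lintegral_congr_ae (g := fun _ => ENNReal.ofReal (1 - α ^ 2) ^ (K - 1))]
  · simp
  · filter_upwards [ae_gain_injective hg] with T hinj
    obtain ⟨p, hp⟩ := exists_strict_max hK hinj
    exact sum_ite_max hp fun _ => ENNReal.ofReal (1 - α ^ 2) ^ (K - 1)

lemma aemeasurable_secondUser_isNone {α : ℝ} {g : Fin K → ℝ} (hg : ∀ k, 0 < g k) (hK : 0 < K) :
    AEMeasurable (fun x => if (secondUser α g x).isSome = true then (0 : ℝ≥0∞) else 1)
      (Measure.pi fun _ : Fin K => channelLaw) := by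
  refine ⟨fun x => ∑ p, soloWeight α p (gain g x) (fun j => corr (x p) (x j)), ?_, ?_⟩
  · exact Finset.measurable_sum _ fun p _ => measurable_soloWeight_channels α g p
  · filter_upwards [ae_channels_generic hg] with x hx
    exact indicator_secondUser_isNone hK hx.2

/-- The event that there is a second selected user, in terms of the channels. -/
def multiUserSet (α : ℝ) (g : Fin K → ℝ) : Set (Fin K → EuclideanSpace ℂ (Fin 2)) :=
  {x | (secondUser α g x).isSome = true}

/-- The indicator agrees with an explicit measurable function only off the null set of ties, hence
null measurability suffices and ties need no analysis. -/
lemma nullMeasurableSet_multiUserSet {α : ℝ} {g : Fin K → ℝ} (hg : ∀ k, 0 < g k) (hK : 0 < K) :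
    NullMeasurableSet (multiUserSet α g) (Measure.pi fun _ : Fin K => channelLaw) := by
  have h := (aemeasurable_secondUser_isNone (α := α) hg hK).nullMeasurable
    (measurableSet_singleton 0)
  convert h using 1
  ext x
  simp [multiUserSet, Option.isSome_iff_ne_none]

lemma measure_multiUserSet {α : ℝ} (hα0 : 0 < α) (hα1 : α ≤ 1) {g : Fin K → ℝ}
    (hg : ∀ k, 0 < g k) (hK : 0 < K) :
    (Measure.pi fun _ : Fin K => channelLaw).real (multiUserSet α g) = 1 - suProb K α := by
  have hn := nullMeasurableSet_multiUserSet (α := α) hg hK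
  have h0 : 0 ≤ 1 - α ^ 2 := by nlinarith
  have hc : (Measure.pi fun _ : Fin K => channelLaw).real (multiUserSet α g)ᶜ = suProb K α := by
    have h := lintegral_secondUser_isNone (α := α) hg hK
    have e : ∀ x, (if (secondUser α g x).isSome = true then (0 : ℝ≥0∞) else 1)
        = (multiUserSet α g)ᶜ.indicator 1 x := fun x => by
      simp only [Set.indicator, Set.mem_compl_iff, multiUserSet, Set.mem_ofPred_eq, Pi.one_apply,
        ite_not]
    simp_rw [e] at h
    rw [lintegral_indicator_one₀ hn.compl] at h
    rw [Measure.real, h, suProb, ENNReal.toReal_pow, ENNReal.toReal_ofReal h0]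
  rw [← hc, probReal_compl_eq_one_sub₀ hn, sub_sub_cancel]

/-! ### Integrability and the unconditional mean of the rate -/

lemma sinr_nonneg (l : Beamforming) (σ : ℝ) {g : Fin K → ℝ} (hg : ∀ k, 0 < g k)
    (x : Fin K → EuclideanSpace ℂ (Fin 2)) (U : Finset (Fin K)) (k : Fin K) :
    0 ≤ sinr l σ g x U k := by
  have := (hg k).le
  unfold sinr effNoise
  positivity

lemma secondUserRate_nonneg (l : Beamforming) (σ α : ℝ) {g : Fin K → ℝ} (hg : ∀ k, 0 < g k)
    (x : Fin K → EuclideanSpace ℂ (Fin 2)) : 0 ≤ secondUserRate l σ α g x := by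
  unfold secondUserRate
  split
  · exact Real.log_nonneg (le_add_of_nonneg_right (sinr_nonneg l σ hg x _ _))
  · exact le_rfl

lemma secondUserRate_eq_zero (l : Beamforming) (σ : ℝ) {α : ℝ} {g : Fin K → ℝ}
    {x : Fin K → EuclideanSpace ℂ (Fin 2)} (hx : x ∉ multiUserSet α g) :
    secondUserRate l σ α g x = 0 := by
  have h : secondUser α g x = none := by
    simpa [multiUserSet] using hx
  rw [secondUserRate, h]
  split <;> simp_all

/-- The nonnegative integral of the rate equals a finite sum of convergent real integrals; its
finiteness gives integrability and its real value gives the formula. -/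
lemma integrable_secondUserRate (l : Beamforming) {σ α : ℝ} (hσ : 0 < σ) (hα0 : 0 < α)
    (hα1 : α ≤ 1) {g : Fin K → ℝ} (hg : ∀ k, 0 < g k) (hK : 0 < K) :
    Integrable (secondUserRate l σ α g) (Measure.pi fun _ : Fin K => channelLaw) ∧
    ∫ x, secondUserRate l σ α g x ∂(Measure.pi fun _ : Fin K => channelLaw)
      = ∑ i ∈ Finset.Icc 2 K, (1 - α ^ 2) ^ (i - 2) *
          ∑ k, σ ^ 4 / g k ^ 2 * ∫ x in Set.Ioi (0 : ℝ), rateIntegrand l σ α g i k x := by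
  have hnn := secondUserRate_nonneg l σ α hg
  have hme := (aemeasurable_ofReal_rate (α := α) l hσ hg hK).ennreal_toReal
  simp_rw [ENNReal.toReal_ofReal (hnn _)] at hme
  have hint := fun i k => integrableOn_rateIntegrand l hσ hα0 hα1 hg i k
  have hI : ∀ i k, 0 ≤ ∫ x in Set.Ioi (0 : ℝ), rateIntegrand l σ α g i k x := fun i k =>
    setIntegral_nonneg measurableSet_Ioi fun x hx =>
      rateIntegrand_nonneg l hσ hα0 hα1 hg i k hx
  have h0 : 0 ≤ 1 - α ^ 2 := by nlinarith
  have hS : ∀ i, 0 ≤ ∑ k, σ ^ 4 / g k ^ 2 *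
      ∫ x in Set.Ioi (0 : ℝ), rateIntegrand l σ α g i k x := fun i =>
    Finset.sum_nonneg fun k _ => mul_nonneg (by positivity) (hI i k)
  have hL : ∫⁻ x, ENNReal.ofReal (secondUserRate l σ α g x)
      ∂(Measure.pi fun _ : Fin K => channelLaw)
      = ENNReal.ofReal (∑ i ∈ Finset.Icc 2 K, (1 - α ^ 2) ^ (i - 2) *
          ∑ k, σ ^ 4 / g k ^ 2 * ∫ x in Set.Ioi (0 : ℝ), rateIntegrand l σ α g i k x) := by
    rw [lintegral_secondUserRate l hσ hα0 hα1 hg hK, ENNReal.ofReal_sum_of_nonneg fun i _ =>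
      mul_nonneg (pow_nonneg h0 _) (hS i)]
    refine Finset.sum_congr rfl fun i _ => ?_
    rw [ENNReal.ofReal_mul (pow_nonneg h0 _), ENNReal.ofReal_pow h0,
      ENNReal.ofReal_sum_of_nonneg fun k _ => mul_nonneg (by positivity) (hI i k)]
    congr 1
    refine Finset.sum_congr rfl fun k _ => ?_
    rw [ENNReal.ofReal_mul (by positivity), ofReal_integral_eq_lintegral_ofReal (hint i k)]
    filter_upwards [ae_restrict_mem measurableSet_Ioi] with x hx
    exact rateIntegrand_nonneg l hσ hα0 hα1 hg i k hx
  refine ⟨⟨hme.aestronglyMeasurable, ?_⟩, ?_⟩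
  · rw [hasFiniteIntegral_iff_ofReal (Filter.Eventually.of_forall hnn), hL]
    exact ENNReal.ofReal_lt_top
  · rw [integral_eq_lintegral_of_nonneg_ae (Filter.Eventually.of_forall hnn)
      hme.aestronglyMeasurable, hL, ENNReal.toReal_ofReal]
    exact Finset.sum_nonneg fun i _ => mul_nonneg (pow_nonneg h0 _) (hS i)

end MaxGain

/-! ### The conditional ergodic rate -/

theorem lemma6 {Ω : Type*} [MeasurableSpace Ω] (μ : Measure Ω) [IsProbabilityMeasure μ]
    {K : ℕ} (hK : 2 ≤ K) (g : Fin K → ℝ) (hg : ∀ k, 0 < g k) (σ : ℝ) (hσ : 0 < σ)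
    (α : ℝ) (hα0 : 0 < α) (hα1 : α ≤ 1)
    (h : Fin K → Ω → EuclideanSpace ℂ (Fin 2))
    (hmeas : ∀ (k : Fin K) (a : Fin 2), Measurable (fun ω => h k ω a))
    (hlaw : ∀ (k : Fin K) (a : Fin 2), μ.map (fun ω => h k ω a) = stdComplexGaussian)
    (hindep : iIndepFun (fun (p : Fin K × Fin 2) (ω : Ω) => h p.1 ω p.2) μ)
    (l : Beamforming) :
    μ.real (muMode α g h) = 1 - suProb K α ∧
    Integrable (fun ω => secondUserRate l σ α g (fun k => h k ω))
      (ProbabilityTheory.cond μ (muMode α g h)) ∧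
    (∀ i ∈ Finset.Icc 2 K, ∀ k : Fin K,
      IntegrableOn (rateIntegrand l σ α g i k) (Set.Ioi 0)) ∧
    ergodicRateSecond μ l σ α g h =
      ∑ i ∈ Finset.Icc 2 K, (1 - α ^ 2) ^ (i - 2) / (1 - suProb K α) *
        ∑ k : Fin K, σ ^ 4 / g k ^ 2 *
          ∫ x in Set.Ioi (0 : ℝ), rateIntegrand l σ α g i k x := by
  have hK0 : 0 < K := by omega
  set X : Ω → Fin K → EuclideanSpace ℂ (Fin 2) := fun ω k => h k ω with hX
  have hXm : Measurable X := measurable_pi_lambda _ fun k => measurable_channel (hmeas k)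
  have hmap : μ.map X = Measure.pi fun _ : Fin K => channelLaw := map_channels hmeas hlaw hindep
  have hmu : muMode α g h = X ⁻¹' multiUserSet α g := rfl
  have hnull : NullMeasurableSet (multiUserSet α g) (μ.map X) := by
    rw [hmap]
    exact nullMeasurableSet_multiUserSet hg hK0
  obtain ⟨hint, hval⟩ := integrable_secondUserRate l hσ hα0 hα1 hg hK0
  rw [← hmap] at hint hval
  have hprob : μ.real (muMode α g h) = 1 - suProb K α := by
    rw [← measure_multiUserSet hα0 hα1 hg hK0, ← hmap, hmu, Measure.real, Measure.real,
      Measure.map_apply₀ hXm.aemeasurable hnull]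
  -- Since `α > 0` and `K - 1 ≥ 1`, `λ < 1`: the conditioning is nondegenerate and the division by
  -- `1 - λ` is legitimate.
  have hpos : μ (muMode α g h) ≠ 0 := by
    intro h0
    have h1 : suProb K α < 1 := by
      refine pow_lt_one₀ (by nlinarith) (by nlinarith) (by omega)
    rw [Measure.real, h0, ENNReal.toReal_zero] at hprob
    linarith
  have hintμ : Integrable (fun ω => secondUserRate l σ α g (fun k => h k ω)) μ :=
    hint.comp_measurable hXm
  have hzero : ∀ ω, ω ∉ muMode α g h → secondUserRate l σ α g (fun k => h k ω) = 0 :=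
    fun ω hω => secondUserRate_eq_zero l σ (x := X ω) hω
  refine ⟨hprob, ?_, fun i _ k => integrableOn_rateIntegrand l hσ hα0 hα1 hg i k, ?_⟩
  · exact hintμ.restrict.smul_measure (ENNReal.inv_ne_top.2 hpos)
  -- The conditional measure is the restriction to MU-Mode over its probability; the restriction can
  -- be dropped because the rate is zero elsewhere.
  · rw [ergodicRateSecond, ProbabilityTheory.cond, integral_smul_measure,
      setIntegral_eq_integral_of_forall_compl_eq_zero hzero, ENNReal.toReal_inv, smul_eq_mul]
    have hcomp : ∫ ω, secondUserRate l σ α g (fun k => h k ω) ∂μ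
        = ∫ x, secondUserRate l σ α g x ∂(μ.map X) :=
      (integral_map hXm.aemeasurable hint.aestronglyMeasurable).symm
    rw [hcomp, hval, ← Measure.real, hprob, Finset.mul_sum]
    refine Finset.sum_congr rfl fun i _ => ?_
    rw [div_eq_inv_mul, mul_assoc]
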